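/- \textbf{Setting.} Consider a Markov decision process with state space $\mathcal S$ (a measurable space with a $\sigma$-finite reference measure $\nu$, e.g. a measurable subset of $\mathbb R^{n_s}$ with Lebesgue measure), action set $\mathcal A\subseteq\mathbb R^{n_a}$, reward $R(s,a)$, transition density $\rho(s^+\mid s,a)$ with respect to $\nu$ (both jointly measurable), initial distribution $\rho_0$ and discount factor $0<\gamma<1$. A policy is a measurable map $\pi:\mathcal S\to\mathcal A$, and $$V^\pi(s)=\sum_{i\ge 0}\gamma^i\,\mathbb E[R(s_i,\pi(s_i))\mid s_0=s,\ s_{i+1}\sim\rho(\cdot\mid s_i,\pi(s_i))],$$ $$Q^\pi(s,a)=R(s,a)+\gamma\,\mathbb E_{s^+\sim\rho(\cdot\mid s,a)}[V^\pi(s^+)],\qquad J(\pi)=\mathbb E_{s_0\sim\rho_0}[V^\pi(s_0)].$$ A policy is optimal if it maximizes $J$ over all policies. Let $(\pi_\theta)_{\theta\in\mathbb R^{n_\theta}}$ be a parameterized family of policies, $J(\theta)=J(\pi_\theta)$, and $$M_2(\theta)=\mathbb E_s\big[\nabla_\theta\pi_\theta(s)^\top\,\nabla_a^2Q^{\pi_\theta}(s,a)|_{a=\pi_\theta(s)}\,\nabla_\theta\pi_\theta(s)\big],$$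 where, as in the deterministic policy gradient theorem, $\mathbb E_s$ is integration against the unnormalized discounted state distribution $\sum_{i\ge0}\gamma^i\,\mathrm{Law}(s_i)$ of the closed loop with $\pi_\theta$ and $s_0\sim\rho_0$. \textbf{Regularity.} $R$ is bounded on $\mathcal S\times\mathcal A$. On the interior of $\mathcal A$, $R(s,\cdot)$ and $\rho(s^+\mid s,\cdot)$ are $C^2$ for all $s,s^+$; the first and second derivatives of $R$ in $a$ are bounded uniformly in $(s,a)$; and there is a constant $C$ such that for every $s$ and every interior $a$ the first and second $a$-derivatives of $\rho(s^+\mid s,\cdot)$ at all points near $a$ are bounded in norm by some $h(s^+)$ with $\int h\,d\nu\le C$. There is a ball around the parameter $\theta^\star$ below on which, for every $s$, $\theta\mapsto\pi_\theta(s)$ is $C^2$ with values in the interior of $\mathcal A$ and with first and second derivatives bounded uniformly in $(\theta,s)$. \textbf{Statement.} Assume: (i) (rich policy) there is an optimal policy $\pi^\star$, and $\theta^\star$ satisfies $\pi_{\theta^\star}(s)=\pi^\star(s)$ for all $s$; (ii) (uniqueness) every optimal policy agrees with $\pi^\star$ at almost every state with respect to the discounted state distribution of $\pi^\star$; (iii)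 $J:\mathbb R^{n_\theta}\to\mathbb R$ is twice differentiable, $\nabla_\theta J(\theta^\star)=0$, and $\nabla^2_\theta J(\theta^\star)$ is negative definite; (iv) $\theta_{k+1}=\theta_k-B_k^{-1}g_k$ with $B_k=M_2(\theta_k)$ and $g_k=\nabla_\theta J(\theta_k)$ for all $k\ge 0$, and $\theta_k\to\theta^\star$. Then $(\theta_k)$ converges superlinearly to $\theta^\star$, i.e. $\|\theta_{k+1}-\theta^\star\|=o(\|\theta_k-\theta^\star\|)$ as $k\to\infty$. -/

import Mathlib

open MeasureTheory Filter Topology Asymptotics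

/-- The Jacobian matrix `∇f(x) ∈ ℝ^{m × n}`. -/
noncomputable def jacobianMatrix {n m : ℕ}
    (f : EuclideanSpace ℝ (Fin n) → EuclideanSpace ℝ (Fin m)) (x : EuclideanSpace ℝ (Fin n)) :
    Matrix (Fin m) (Fin n) ℝ :=
  Matrix.of fun i j => (fderiv ℝ f x (EuclideanSpace.single j 1)) i

/-- The Hessian matrix `∇²f(x)`. -/
noncomputable def hessianMatrix {n : ℕ}
    (f : EuclideanSpace ℝ (Fin n) → ℝ) (x : EuclideanSpace ℝ (Fin n)) :
    Matrix (Fin n) (Fin n) ℝ :=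
  Matrix.of fun i j =>
    fderiv ℝ (fderiv ℝ f) x (EuclideanSpace.single i 1) (EuclideanSpace.single j 1)

/-- `x k → x⋆` with `‖x (k+1) - x⋆‖ = o(‖x k - x⋆‖)`. -/
def ConvergesSuperlinearly {E : Type*} [NormedAddCommGroup E] (x : ℕ → E) (xstar : E) : Prop :=
  Tendsto x atTop (𝓝 xstar) ∧
    (fun k => x (k + 1) - xstar) =o[atTop] (fun k => x k - xstar)

/-- A discounted Markov decision process with state space `S` (reference measure `ν`, for
instance Lebesgue measure), action set `A ⊆ ℝ^m`, reward `R s a`, transition density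
`density s a s' = ρ(s' | s, a)` with respect to `ν`, discount factor `γ` and initial
distribution `init`. Values of `R` and `density` at actions outside `A` play no role. -/
structure MDP (S : Type*) [MeasurableSpace S] (ν : Measure S) (m : ℕ) where
  A : Set (EuclideanSpace ℝ (Fin m))
  R : S → EuclideanSpace ℝ (Fin m) → ℝ
  density : S → EuclideanSpace ℝ (Fin m) → S → ℝ
  γ : ℝ
  init : Measure S
  measurable_R : Measurable fun p : S × EuclideanSpace ℝ (Fin m) => R p.1 p.2
  measurable_density :
    Measurable fun p : (S × EuclideanSpace ℝ (Fin m)) × S => density p.1.1 p.1.2 p.2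
  density_nonneg : ∀ s, ∀ a ∈ A, ∀ s', 0 ≤ density s a s'
  lintegral_density : ∀ s, ∀ a ∈ A, ∫⁻ s', ENNReal.ofReal (density s a s') ∂ν = 1
  γ_pos : 0 < γ
  γ_lt_one : γ < 1
  isProbabilityMeasure_init : IsProbabilityMeasure init

namespace MDP

variable {S : Type*} [MeasurableSpace S] {ν : Measure S} {m : ℕ}

/-- Deterministic policies: measurable maps from states to admissible actions. -/
def IsPolicy (M : MDP S ν m) (π : S → EuclideanSpace ℝ (Fin m)) : Prop :=
  Measurable π ∧ ∀ s, π s ∈ M.A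

/-- The law `ρ(· | s, a)` of the next state. -/
noncomputable def transition (M : MDP S ν m) (s : S) (a : EuclideanSpace ℝ (Fin m)) : Measure S :=
  ν.withDensity fun s' => ENNReal.ofReal (M.density s a s')

/-- The law of the state `s_i` in closed loop with the policy `π`, when `s_0 ∼ μ`. -/
noncomputable def stateLaw (M : MDP S ν m) (π : S → EuclideanSpace ℝ (Fin m)) (μ : Measure S) :
    ℕ → Measure S
  | 0 => μ
  | i + 1 => (M.stateLaw π μ i).bind fun s => M.transition s (π s)

/-- The state-value function `V^π(s) = ∑ γ^i 𝔼[R(s_i, π(s_i)) | s_0 = s]`. -/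
noncomputable def V (M : MDP S ν m) (π : S → EuclideanSpace ℝ (Fin m)) (s : S) : ℝ :=
  ∑' i : ℕ, M.γ ^ i * ∫ x, M.R x (π x) ∂(M.stateLaw π (Measure.dirac s) i)

/-- The action-value function `Q^π(s, a) = R(s, a) + γ 𝔼_{s⁺ ∼ ρ(·|s,a)}[V^π(s⁺)]`. -/
noncomputable def Q (M : MDP S ν m) (π : S → EuclideanSpace ℝ (Fin m)) (s : S)
    (a : EuclideanSpace ℝ (Fin m)) : ℝ :=
  M.R s a + M.γ * ∫ s', M.V π s' ∂(M.transition s a)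

/-- The expected cumulative reward `J(π) = 𝔼_{s_0 ∼ ρ_0}[V^π(s_0)]`. -/
noncomputable def J (M : MDP S ν m) (π : S → EuclideanSpace ℝ (Fin m)) : ℝ :=
  ∫ s, M.V π s ∂M.init

/-- The (unnormalized) discounted state distribution `∑ γ^i Law(s_i)` in closed loop with `π`,
over which the expectations `𝔼_s` of the policy gradient and of `M₂` are taken. -/
noncomputable def visitation (M : MDP S ν m) (π : S → EuclideanSpace ℝ (Fin m)) : Measure S :=
  Measure.sum fun i : ℕ => ENNReal.ofReal (M.γ ^ i) • M.stateLaw π M.init i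

/-- The Gauss-Newton matrix
`M₂(θ) = 𝔼_s[∇_θ π_θ(s)ᵀ ∇²_a Q^{π_θ}(s, a)|_{a = π_θ(s)} ∇_θ π_θ(s)]`. -/
noncomputable def M₂ (M : MDP S ν m) {n : ℕ}
    (π : EuclideanSpace ℝ (Fin n) → S → EuclideanSpace ℝ (Fin m))
    (θ : EuclideanSpace ℝ (Fin n)) : Matrix (Fin n) (Fin n) ℝ :=
  Matrix.of fun i j => ∫ s,
    ((jacobianMatrix (fun θ' => π θ' s) θ).transpose * hessianMatrix (M.Q (π θ) s) (π θ s) *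
      jacobianMatrix (fun θ' => π θ' s) θ) i j ∂(M.visitation (π θ))

/-- `π` maximizes the expected cumulative reward over all policies. -/
def IsOptimal (M : MDP S ν m) (π : S → EuclideanSpace ℝ (Fin m)) : Prop :=
  M.IsPolicy π ∧ ∀ π', M.IsPolicy π' → M.J π' ≤ M.J π

/-- `π` is the unique optimal policy, where policies are identified if they agree at almost all
states encountered under `π` (changing a policy at states that are never encountered does not
change its expected cumulative reward). -/
def IsUniqueOptimal (M : MDP S ν m) (π : S → EuclideanSpace ℝ (Fin m)) : Prop :=
  M.IsOptimal π ∧ ∀ π', M.IsOptimal π' → π' =ᵐ[M.visitation π] π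

/-- Regularity of the data: the reward is bounded; reward and transition density are `C²` in the
action on the interior of `A`, with derivatives bounded uniformly, for the density in the
`L¹(ν)` sense. -/
def IsRegular (M : MDP S ν m) : Prop :=
  ∃ C : ℝ,
    (∀ s, ∀ a ∈ M.A, |M.R s a| ≤ C) ∧
    (∀ s, ContDiffOn ℝ 2 (M.R s) (interior M.A)) ∧
    (∀ s, ∀ a ∈ interior M.A,
      ‖fderiv ℝ (M.R s) a‖ ≤ C ∧ ‖fderiv ℝ (fderiv ℝ (M.R s)) a‖ ≤ C) ∧
    (∀ s s', ContDiffOn ℝ 2 (fun a => M.density s a s') (interior M.A)) ∧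
    (∀ s, ∀ a ∈ interior M.A, ∃ h : S → ℝ, Integrable h ν ∧ ∫ s', h s' ∂ν ≤ C ∧
      ∀ᶠ b in 𝓝 a, ∀ s', ‖fderiv ℝ (fun a' => M.density s a' s') b‖ ≤ h s' ∧
        ‖fderiv ℝ (fderiv ℝ fun a' => M.density s a' s') b‖ ≤ h s')

/-- Regularity of the parameterized policy for `θ` near `θstar`: the actions are interior, and
the policy is `C²` in `θ` with derivatives bounded uniformly in the state. -/
def IsRegularPolicyNear (M : MDP S ν m) {n : ℕ}
    (π : EuclideanSpace ℝ (Fin n) → S → EuclideanSpace ℝ (Fin m))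
    (θstar : EuclideanSpace ℝ (Fin n)) : Prop :=
  ∃ C : ℝ, ∃ r > 0, ∀ s,
    ContDiffOn ℝ 2 (fun θ => π θ s) (Metric.ball θstar r) ∧
    ∀ θ ∈ Metric.ball θstar r, π θ s ∈ interior M.A ∧
      ‖fderiv ℝ (fun θ' => π θ' s) θ‖ ≤ C ∧
      ‖fderiv ℝ (fderiv ℝ fun θ' => π θ' s) θ‖ ≤ C

end MDP

/-! The point is that `M₂` coincides with the Hessian of `J` at `θstar`, although away from an
optimum it is only part of that Hessian. Once this is known (`SmoothFamily.M₂_eq_hessianMatrix`) and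
`M₂` is continuous at `θstar` (`SmoothFamily.tendsto_M₂`), the matrices `B_k` tend to an invertible
Hessian, and the usual quasi-Newton estimate gives superlinear convergence
(`convergesSuperlinearly_quasiNewton`).

The Hessian identity rests on the performance difference identity `J_sub_J`: `J(π_θ) - J(π⋆)` is the
integral of the advantage `Q⋆(s, π_θ(s)) - V⋆(s)` against the visitation measure of `π_θ`.
Optimality and uniqueness make the action gradient of `Q⋆` vanish at `π⋆(s)` outside a set `N` never
visited by `π⋆`. Off `N` the advantage is therefore `O(‖θ - θstar‖²)`, while the state laws move by
`O(‖θ - θstar‖)` in total variation. On `N` the advantage is only `O(‖θ - θstar‖)`, but the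
probability of visiting `N` is `O(‖θ - θstar‖²)`: it is a nonnegative quantity that vanishes at
`θstar`. Hence the visitation measure of `π_θ` can be replaced by that of `π⋆` at third-order cost
(`SmoothFamily.exists_abs_J_sub_le`).

Against this fixed measure, the second-order Taylor coefficient along each line is computed by
dominated convergence. The term with `∇²_θ π_θ` drops out with the gradient of `Q⋆`, which leaves
half the quadratic form of `M₂`; polarization then identifies the matrices. -/

/-! ### Bounded measurable functions and discounted sums. -/

/-- A real function that is measurable and bounded in absolute value by `c`. -/
structure MeasurableBoundedBy {S : Type*} [MeasurableSpace S] (f : S → ℝ) (c : ℝ) : Prop where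
  measurable : Measurable f
  abs_le : ∀ x, |f x| ≤ c

namespace MeasurableBoundedBy

variable {S : Type*} [MeasurableSpace S] {f g : S → ℝ} {c d : ℝ}

theorem integrable (hf : MeasurableBoundedBy f c) (μ : Measure S) [IsFiniteMeasure μ] :
    Integrable f μ :=
  Integrable.of_bound hf.measurable.aestronglyMeasurable c
    (Eventually.of_forall fun x => by simpa using hf.abs_le x)

theorem abs_integral_le (hf : MeasurableBoundedBy f c) (μ : Measure S) [IsProbabilityMeasure μ] :
    |∫ x, f x ∂μ| ≤ c := by
  have := norm_integral_le_of_norm_le_const (μ := μ) (f := f) (C := c)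
    (Eventually.of_forall fun x => by simpa using hf.abs_le x)
  simpa using this

theorem sub (hf : MeasurableBoundedBy f c) (hg : MeasurableBoundedBy g d) :
    MeasurableBoundedBy (fun x => f x - g x) (c + d) :=
  ⟨hf.measurable.sub hg.measurable, fun x =>
    (abs_sub _ _).trans (add_le_add (hf.abs_le x) (hg.abs_le x))⟩

theorem add (hf : MeasurableBoundedBy f c) (hg : MeasurableBoundedBy g d) :
    MeasurableBoundedBy (fun x => f x + g x) (c + d) :=
  ⟨hf.measurable.add hg.measurable, fun x =>
    (abs_add_le _ _).trans (add_le_add (hf.abs_le x) (hg.abs_le x))⟩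

theorem const_mul (hf : MeasurableBoundedBy f c) (a : ℝ) :
    MeasurableBoundedBy (fun x => a * f x) (|a| * c) :=
  ⟨hf.measurable.const_mul a, fun x => by
    rw [abs_mul]; exact mul_le_mul_of_nonneg_left (hf.abs_le x) (abs_nonneg a)⟩

theorem indicator_one {N : Set S} (hN : MeasurableSet N) :
    MeasurableBoundedBy (N.indicator fun _ => (1 : ℝ)) 1 :=
  ⟨measurable_const.indicator hN, fun x => by
    by_cases hx : x ∈ N <;> simp [hx]⟩

theorem indicator (hf : MeasurableBoundedBy f c) {N : Set S} (hN : MeasurableSet N) :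
    MeasurableBoundedBy (N.indicator f) c :=
  ⟨hf.measurable.indicator hN, fun x => by
    have := hf.abs_le x
    by_cases hx : x ∈ N
    · simpa [hx] using this
    · simpa [hx] using (abs_nonneg _).trans this⟩

end MeasurableBoundedBy

/-- The sum telescopes. With `u i` the expected value of `V^π` at time `i` along another policy, it
rewrites `J π` as a discounted sum over the trajectory of that policy. -/
theorem hasSum_pow_mul_sub_succ {γ : ℝ} (hγ : 0 < γ) (hγ1 : γ < 1) {u : ℕ → ℝ} {c : ℝ}
    (hu : ∀ i, |u i| ≤ c) :
    HasSum (fun i => γ ^ i * (u i - γ * u (i + 1))) (u 0) := by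
  have hs : Summable fun i => γ ^ i * u i :=
    Summable.of_norm_bounded ((summable_geometric_of_lt_one hγ.le hγ1).mul_right c) fun i => by
      rw [norm_mul, norm_pow, Real.norm_of_nonneg hγ.le]
      exact mul_le_mul_of_nonneg_left (hu i) (by positivity)
  have h1 := hs.hasSum
  have h2 := (hasSum_nat_add_iff' 1).2 h1
  have h3 := h1.sub h2
  simp only [Finset.range_one, Finset.sum_singleton, pow_zero, one_mul, sub_sub_cancel] at h3
  exact h3.congr_fun fun i => by ring

/-! ### State laws, Bellman equation and performance difference. -/

namespace MDP

variable {S : Type*} [MeasurableSpace S] {ν : Measure S} {m : ℕ}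

theorem isProbabilityMeasure_transition (M : MDP S ν m) (s : S) {a : EuclideanSpace ℝ (Fin m)}
    (ha : a ∈ M.A) : IsProbabilityMeasure (M.transition s a) :=
  ⟨by rw [transition, withDensity_apply _ MeasurableSet.univ, Measure.restrict_univ,
    M.lintegral_density s a ha]⟩

theorem measurable_density_right (M : MDP S ν m) (s : S) (a : EuclideanSpace ℝ (Fin m)) :
    Measurable (M.density s a) :=
  M.measurable_density.comp (measurable_const (a := (s, a)).prodMk measurable_id)

/-- The `max` is the trace of `ENNReal.ofReal`: the density may be negative at actions outside `A`.
Keeping it makes the formula valid, and measurable in the action, on the whole space. -/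
theorem integral_transition (M : MDP S ν m) (s : S) (a : EuclideanSpace ℝ (Fin m)) (g : S → ℝ) :
    ∫ x, g x ∂M.transition s a = ∫ x, max (M.density s a x) 0 * g x ∂ν := by
  rw [transition, integral_withDensity_eq_integral_toReal_smul
    (M.measurable_density_right s a).ennreal_ofReal (by simp)]
  simp [ENNReal.toReal_ofReal']

theorem measurable_integral_transition [SigmaFinite ν] (M : MDP S ν m) {g : S → ℝ}
    (hg : Measurable g) :
    Measurable fun p : S × EuclideanSpace ℝ (Fin m) => ∫ x, g x ∂M.transition p.1 p.2 := by
  simp_rw [integral_transition]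
  refine (StronglyMeasurable.integral_prod_right ?_).measurable
  exact ((M.measurable_density.max measurable_const).mul
    (hg.comp measurable_snd)).stronglyMeasurable

theorem measurable_transition [SigmaFinite ν] (M : MDP S ν m)
    {π : S → EuclideanSpace ℝ (Fin m)} (hπ : Measurable π) :
    Measurable fun s => M.transition s (π s) := by
  refine Measure.measurable_of_measurable_coe _ fun B hB => ?_
  simp only [transition, withDensity_apply _ hB]
  refine Measurable.lintegral_prod_right (f := fun s s' =>
    ENNReal.ofReal (M.density s (π s) s')) ?_
  exact (M.measurable_density.comp ((measurable_fst.prodMk (hπ.comp measurable_fst)).prodMk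
    measurable_snd)).ennreal_ofReal

/-- The transition kernel in closed loop with a policy. -/
noncomputable def closedLoop [SigmaFinite ν] (M : MDP S ν m) {π : S → EuclideanSpace ℝ (Fin m)}
    (hπ : M.IsPolicy π) : ProbabilityTheory.Kernel S S :=
  ⟨fun s => M.transition s (π s), M.measurable_transition hπ.1⟩

instance [SigmaFinite ν] (M : MDP S ν m) {π : S → EuclideanSpace ℝ (Fin m)}
    (hπ : M.IsPolicy π) : ProbabilityTheory.IsMarkovKernel (M.closedLoop hπ) :=
  ⟨fun s => M.isProbabilityMeasure_transition s (hπ.2 s)⟩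

section

variable {M : MDP S ν m} {π : S → EuclideanSpace ℝ (Fin m)}

/-- The recursion defining `stateLaw` splits off the last transition; splitting off the first is
what the Bellman equation needs. -/
theorem stateLaw_succ' (π : S → EuclideanSpace ℝ (Fin m)) (μ : Measure S) (i : ℕ) :
    M.stateLaw π μ (i + 1) = M.stateLaw π (μ.bind fun s => M.transition s (π s)) i := by
  induction i with
  | zero => rfl
  | succ i ih =>
    change (M.stateLaw π μ (i + 1)).bind _ = _
    rw [ih]
    rfl

theorem summable_pow_mul (M : MDP S ν m) {u : ℕ → ℝ} {c : ℝ} (hu : ∀ i, |u i| ≤ c) :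
    Summable fun i => M.γ ^ i * u i :=
  Summable.of_norm_bounded ((summable_geometric_of_lt_one M.γ_pos.le M.γ_lt_one).mul_right c)
    fun i => by
      rw [norm_mul, norm_pow, Real.norm_of_nonneg M.γ_pos.le]
      exact mul_le_mul_of_nonneg_left (hu i) (pow_nonneg M.γ_pos.le i)

theorem abs_tsum_pow_mul_le (M : MDP S ν m) {u : ℕ → ℝ} {c : ℝ} (hu : ∀ i, |u i| ≤ c) :
    |∑' i, M.γ ^ i * u i| ≤ c / (1 - M.γ) := by
  have h := (hasSum_geometric_of_lt_one M.γ_pos.le M.γ_lt_one).mul_right c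
  rw [div_eq_inv_mul]
  refine tsum_of_norm_bounded (f := fun i => M.γ ^ i * u i) h fun i => ?_
  rw [norm_mul, norm_pow, Real.norm_of_nonneg M.γ_pos.le]
  exact mul_le_mul_of_nonneg_left (hu i) (pow_nonneg M.γ_pos.le i)

theorem measurableBoundedBy_reward {C : ℝ} (hR : ∀ s, ∀ a ∈ M.A, |M.R s a| ≤ C)
    (hπ : M.IsPolicy π) : MeasurableBoundedBy (fun s => M.R s (π s)) C :=
  ⟨M.measurable_R.comp (measurable_id.prodMk hπ.1), fun s => hR s _ (hπ.2 s)⟩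

theorem ae_visitation_iff {p : S → Prop} :
    (∀ᵐ s ∂M.visitation π, p s) ↔ ∀ i, ∀ᵐ s ∂M.stateLaw π M.init i, p s := by
  rw [visitation, Measure.ae_sum_iff]
  refine forall_congr' fun i => ?_
  rw [Measure.ae_ennreal_smul_measure_iff]
  simpa using pow_pos M.γ_pos i

end

section Policy

variable [SigmaFinite ν] {M : MDP S ν m} {π : S → EuclideanSpace ℝ (Fin m)}

theorem stateLaw_succ_eq_bind_closedLoop (hπ : M.IsPolicy π) (μ : Measure S) (i : ℕ) :
    M.stateLaw π μ (i + 1) = (M.stateLaw π μ i).bind (M.closedLoop hπ) := rfl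

theorem isProbabilityMeasure_stateLaw (hπ : M.IsPolicy π) (μ : Measure S) [IsProbabilityMeasure μ]
    (i : ℕ) : IsProbabilityMeasure (M.stateLaw π μ i) := by
  induction i with
  | zero => assumption
  | succ i ih =>
    rw [stateLaw_succ_eq_bind_closedLoop hπ]
    infer_instance

/-- The expectation of the next value of `g` in closed loop. -/
theorem _root_.MeasurableBoundedBy.integral_transition {g : S → ℝ} {c : ℝ}
    (hg : MeasurableBoundedBy g c) (hπ : M.IsPolicy π) :
    MeasurableBoundedBy (fun s => ∫ x, g x ∂M.transition s (π s)) c := by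
  refine ⟨(M.measurable_integral_transition hg.measurable).comp
    (f := fun s => (s, π s)) (measurable_id.prodMk hπ.1), fun s => ?_⟩
  have := M.isProbabilityMeasure_transition s (hπ.2 s)
  exact hg.abs_integral_le _

theorem integral_stateLaw_succ (hπ : M.IsPolicy π) (μ : Measure S) [IsProbabilityMeasure μ]
    {g : S → ℝ} {c : ℝ} (hg : MeasurableBoundedBy g c) (i : ℕ) :
    ∫ x, g x ∂M.stateLaw π μ (i + 1) =
      ∫ s, ∫ x, g x ∂M.transition s (π s) ∂M.stateLaw π μ i := by
  have := isProbabilityMeasure_stateLaw hπ μ i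
  rw [stateLaw_succ_eq_bind_closedLoop hπ, Measure.comp_eq_comp_const_apply,
    ProbabilityTheory.Kernel.integral_comp (hg.integrable _)]
  rfl

/-- Measurability in the initial state and disintegration over it are proved for all `g` at once,
because the induction step replaces `g` by its one-step conditional expectation. -/
theorem measurableBoundedBy_integral_stateLaw_dirac (hπ : M.IsPolicy π) (i : ℕ) :
    ∀ {g : S → ℝ} {c : ℝ}, MeasurableBoundedBy g c →
      MeasurableBoundedBy (fun s => ∫ x, g x ∂M.stateLaw π (Measure.dirac s) i) c ∧
      ∀ (μ : Measure S) [IsProbabilityMeasure μ],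
        ∫ s, ∫ x, g x ∂M.stateLaw π (Measure.dirac s) i ∂μ = ∫ x, g x ∂M.stateLaw π μ i := by
  induction i with
  | zero =>
    intro g c hg
    have h : ∀ s, ∫ x, g x ∂M.stateLaw π (Measure.dirac s) 0 = g s := fun s =>
      integral_dirac' _ _ hg.measurable.stronglyMeasurable
    simp only [h]
    exact ⟨hg, fun μ _ => rfl⟩
  | succ i ih =>
    intro g c hg
    have h : ∀ s, ∫ x, g x ∂M.stateLaw π (Measure.dirac s) (i + 1) =
        ∫ y, ∫ x, g x ∂M.transition y (π y) ∂M.stateLaw π (Measure.dirac s) i := fun s =>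
      integral_stateLaw_succ hπ _ hg i
    simp only [h]
    refine ⟨(ih (hg.integral_transition hπ)).1, fun μ _ => ?_⟩
    rw [(ih (hg.integral_transition hπ)).2, integral_stateLaw_succ hπ μ hg]

theorem abs_integral_stateLaw_le (hπ : M.IsPolicy π) (μ : Measure S) [IsProbabilityMeasure μ]
    {g : S → ℝ} {c : ℝ} (hg : MeasurableBoundedBy g c) (i : ℕ) :
    |∫ x, g x ∂M.stateLaw π μ i| ≤ c := by
  have := isProbabilityMeasure_stateLaw hπ μ i
  exact hg.abs_integral_le _

theorem measurableBoundedBy_V {C : ℝ} (hR : ∀ s, ∀ a ∈ M.A, |M.R s a| ≤ C)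
    (hπ : M.IsPolicy π) : MeasurableBoundedBy (M.V π) (C / (1 - M.γ)) := by
  have hr := measurableBoundedBy_reward hR hπ
  refine ⟨?_, fun s => abs_tsum_pow_mul_le M fun i => abs_integral_stateLaw_le hπ _ hr i⟩
  refine Measurable.tsum fun i => ?_
  exact (measurableBoundedBy_integral_stateLaw_dirac hπ i hr).1.measurable.const_mul _

theorem integral_V {C : ℝ} (hR : ∀ s, ∀ a ∈ M.A, |M.R s a| ≤ C) (hπ : M.IsPolicy π)
    (μ : Measure S) [IsProbabilityMeasure μ] :
    ∫ s, M.V π s ∂μ = ∑' i, M.γ ^ i * ∫ x, M.R x (π x) ∂M.stateLaw π μ i := by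
  have hr := measurableBoundedBy_reward hR hπ
  have hb := fun i => (measurableBoundedBy_integral_stateLaw_dirac hπ i hr)
  have hγ := M.γ_pos.le
  refine ((hasSum_integral_of_summable_integral_norm (μ := μ)
    (F := fun i s => M.γ ^ i * ∫ x, M.R x (π x) ∂M.stateLaw π (Measure.dirac s) i)
    (fun i => ((hb i).1.const_mul _).integrable μ) ?_).tsum_eq.symm).trans ?_
  · simp_rw [norm_mul, integral_const_mul, norm_pow, Real.norm_of_nonneg hγ]
    refine summable_pow_mul M (c := C) fun i => ?_
    have h : MeasurableBoundedBy
        (fun s => ‖∫ x, M.R x (π x) ∂M.stateLaw π (Measure.dirac s) i‖) C :=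
      ⟨(hb i).1.measurable.norm, fun s => by simpa using (hb i).1.abs_le s⟩
    exact h.abs_integral_le μ
  · simp_rw [integral_const_mul, (hb _).2 μ]

theorem V_eq_Q {C : ℝ} (hR : ∀ s, ∀ a ∈ M.A, |M.R s a| ≤ C) (hπ : M.IsPolicy π) (s : S) :
    M.V π s = M.Q π s (π s) := by
  have hr := measurableBoundedBy_reward hR hπ
  have := M.isProbabilityMeasure_transition s (hπ.2 s)
  rw [Q, integral_V hR hπ, V, (summable_pow_mul M fun i =>
    abs_integral_stateLaw_le hπ (Measure.dirac s) hr i).tsum_eq_zero_add]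
  congr 1
  · rw [pow_zero, one_mul]
    exact integral_dirac' _ _ hr.measurable.stronglyMeasurable
  · rw [← tsum_mul_left]
    refine tsum_congr fun i => ?_
    rw [stateLaw_succ', Measure.dirac_bind (M.measurable_transition hπ.1), pow_succ]
    ring

theorem isFiniteMeasure_visitation (hπ : M.IsPolicy π) : IsFiniteMeasure (M.visitation π) := by
  have := M.isProbabilityMeasure_init
  have := isProbabilityMeasure_stateLaw hπ M.init
  refine ⟨?_⟩
  rw [visitation, Measure.sum_apply _ MeasurableSet.univ]
  simp only [Measure.smul_apply, measure_univ, smul_eq_mul, mul_one]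
  rw [← ENNReal.ofReal_tsum_of_nonneg (fun i => pow_nonneg M.γ_pos.le i)
    (summable_geometric_of_lt_one M.γ_pos.le M.γ_lt_one)]
  exact ENNReal.ofReal_lt_top

theorem hasSum_integral_visitation (hπ : M.IsPolicy π) {g : S → ℝ} {c : ℝ}
    (hg : MeasurableBoundedBy g c) :
    HasSum (fun i => M.γ ^ i * ∫ x, g x ∂M.stateLaw π M.init i)
      (∫ x, g x ∂M.visitation π) := by
  have := isFiniteMeasure_visitation hπ
  have h := hasSum_integral_measure (hg.integrable (M.visitation π))
  refine h.congr_fun fun i => ?_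
  rw [integral_smul_measure, ENNReal.toReal_ofReal (pow_nonneg M.γ_pos.le _), smul_eq_mul]

theorem measurable_Q {C : ℝ} (hR : ∀ s, ∀ a ∈ M.A, |M.R s a| ≤ C) (hπ : M.IsPolicy π) :
    Measurable fun p : S × EuclideanSpace ℝ (Fin m) => M.Q π p.1 p.2 :=
  M.measurable_R.add
    ((M.measurable_integral_transition (measurableBoundedBy_V hR hπ).measurable).const_mul _)

/-- The advantage, relative to `π`, of the actions of another policy. -/
theorem measurableBoundedBy_advantage {C : ℝ} (hR : ∀ s, ∀ a ∈ M.A, |M.R s a| ≤ C)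
    (hπ : M.IsPolicy π) {π' : S → EuclideanSpace ℝ (Fin m)} (hπ' : M.IsPolicy π') :
    MeasurableBoundedBy (fun s => M.Q π s (π' s) - M.V π s)
      (C + |M.γ| * (C / (1 - M.γ)) + C / (1 - M.γ)) :=
  ((measurableBoundedBy_reward hR hπ').add
    (((measurableBoundedBy_V hR hπ).integral_transition hπ').const_mul M.γ)).sub
    (measurableBoundedBy_V hR hπ)

/-- The performance difference identity. -/
theorem J_sub_J {C : ℝ} (hR : ∀ s, ∀ a ∈ M.A, |M.R s a| ≤ C)
    (hπ : M.IsPolicy π) {π' : S → EuclideanSpace ℝ (Fin m)} (hπ' : M.IsPolicy π') :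
    M.J π' - M.J π = ∫ s, (M.Q π s (π' s) - M.V π s) ∂M.visitation π' := by
  have := M.isProbabilityMeasure_init
  have hL := isProbabilityMeasure_stateLaw hπ' M.init
  have hr := measurableBoundedBy_reward hR hπ'
  have hV := measurableBoundedBy_V hR hπ
  have hPV := hV.integral_transition hπ'
  rw [← (hasSum_integral_visitation hπ' (measurableBoundedBy_advantage hR hπ hπ')).tsum_eq, J, J,
    integral_V hR hπ' M.init]
  have h1 := (summable_pow_mul M fun i => abs_integral_stateLaw_le hπ' M.init hr i).hasSum
  -- The telescoping sum starts from the mean of `V^π` under the initial law, which is `J π`; its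
  -- terms combine with the rewards of `π'` into the advantage.
  have h2 := hasSum_pow_mul_sub_succ M.γ_pos M.γ_lt_one
    (fun i => abs_integral_stateLaw_le hπ' M.init hV i)
  refine ((h1.sub h2).tsum_eq.symm.trans (tsum_congr fun i => ?_))
  rw [integral_stateLaw_succ hπ' _ hV, ← mul_sub]
  congr 1
  simp only [Q]
  rw [integral_sub ((hr.add (hPV.const_mul _)).integrable _) (hV.integrable _),
    integral_add (hr.integrable _) ((hPV.const_mul _).integrable _), integral_const_mul]
  ring

end Policy

end MDP

/-! ### Calculus of functions with bounded first and second derivatives. -/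

/-- `f` is `C²` on the open set `U`, with first and second derivatives bounded by `K` there. -/
structure BoundedC2On {E F : Type*} [NormedAddCommGroup E] [NormedSpace ℝ E]
    [NormedAddCommGroup F] [NormedSpace ℝ F] (f : E → F) (U : Set E) (K : ℝ) : Prop where
  isOpen : IsOpen U
  contDiffOn : ContDiffOn ℝ 2 f U
  norm_fderiv_le : ∀ x ∈ U, ‖fderiv ℝ f x‖ ≤ K
  norm_fderiv_fderiv_le : ∀ x ∈ U, ‖fderiv ℝ (fderiv ℝ f) x‖ ≤ K

namespace BoundedC2On

variable {E F G : Type*} [NormedAddCommGroup E] [NormedSpace ℝ E]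
    [NormedAddCommGroup F] [NormedSpace ℝ F] [NormedAddCommGroup G] [NormedSpace ℝ G]
    {f g : E → F} {U : Set E} {K L : ℝ} {x y : E}

theorem contDiffAt (hf : BoundedC2On f U K) (hx : x ∈ U) : ContDiffAt ℝ 2 f x :=
  hf.contDiffOn.contDiffAt (hf.isOpen.mem_nhds hx)

theorem differentiableAt (hf : BoundedC2On f U K) (hx : x ∈ U) : DifferentiableAt ℝ f x :=
  (hf.contDiffAt hx).differentiableAt (by norm_num)

theorem contDiffAt_fderiv (hf : BoundedC2On f U K) (hx : x ∈ U) : ContDiffAt ℝ 1 (fderiv ℝ f) x :=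
  (hf.contDiffAt hx).fderiv_right (by norm_num)

theorem differentiableAt_fderiv (hf : BoundedC2On f U K) (hx : x ∈ U) :
    DifferentiableAt ℝ (fderiv ℝ f) x :=
  (hf.contDiffAt_fderiv hx).differentiableAt (by norm_num)

theorem continuousAt_fderiv_fderiv (hf : BoundedC2On f U K) (hx : x ∈ U) :
    ContinuousAt (fderiv ℝ (fderiv ℝ f)) x :=
  ((hf.contDiffAt_fderiv hx).fderiv_right (m := 0) (by norm_num)).continuousAt

theorem nonneg (hf : BoundedC2On f U K) (hx : x ∈ U) : 0 ≤ K :=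
  (norm_nonneg _).trans (hf.norm_fderiv_le x hx)

theorem fderiv_fderiv_comm (hf : BoundedC2On f U K) (hx : x ∈ U) (v w : E) :
    fderiv ℝ (fderiv ℝ f) x v w = fderiv ℝ (fderiv ℝ f) x w v :=
  (hf.contDiffAt hx).isSymmSndFDerivAt (by simp) v w

theorem of_differentiableAt (hU : IsOpen U) (h1 : ∀ x ∈ U, DifferentiableAt ℝ f x)
    (h2 : ∀ x ∈ U, DifferentiableAt ℝ (fderiv ℝ f) x)
    (h3 : ∀ x ∈ U, ContinuousAt (fderiv ℝ (fderiv ℝ f)) x)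
    (hK1 : ∀ x ∈ U, ‖fderiv ℝ f x‖ ≤ K) (hK2 : ∀ x ∈ U, ‖fderiv ℝ (fderiv ℝ f) x‖ ≤ K) :
    BoundedC2On f U K := by
  refine ⟨hU, ?_, hK1, hK2⟩
  rw [show (2 : WithTop ℕ∞) = 1 + 1 by norm_num, contDiffOn_succ_iff_fderiv_of_isOpen hU]
  refine ⟨fun x hx => (h1 x hx).differentiableWithinAt, by simp, ?_⟩
  rw [show (1 : WithTop ℕ∞) = 0 + 1 by norm_num, contDiffOn_succ_iff_fderiv_of_isOpen hU]
  exact ⟨fun x hx => (h2 x hx).differentiableWithinAt, by simp,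
    contDiffOn_zero.2 fun x hx => (h3 x hx).continuousWithinAt⟩

theorem fderiv_add_eventuallyEq (hf : BoundedC2On f U K) (hg : BoundedC2On g U L) (hx : x ∈ U) :
    fderiv ℝ (fun y => f y + g y) =ᶠ[𝓝 x] fun y => fderiv ℝ f y + fderiv ℝ g y := by
  filter_upwards [hf.isOpen.mem_nhds hx] with y hy
  exact fderiv_fun_add (hf.differentiableAt hy) (hg.differentiableAt hy)

theorem fderiv_fderiv_add (hf : BoundedC2On f U K) (hg : BoundedC2On g U L) (hx : x ∈ U) :
    fderiv ℝ (fderiv ℝ fun y => f y + g y) x =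
      fderiv ℝ (fderiv ℝ f) x + fderiv ℝ (fderiv ℝ g) x := by
  rw [(hf.fderiv_add_eventuallyEq hg hx).fderiv_eq]
  exact fderiv_fun_add (hf.differentiableAt_fderiv hx) (hg.differentiableAt_fderiv hx)

theorem add (hf : BoundedC2On f U K) (hg : BoundedC2On g U L) :
    BoundedC2On (fun y => f y + g y) U (K + L) := by
  refine ⟨hf.isOpen, hf.contDiffOn.add hg.contDiffOn, fun x hx => ?_, fun x hx => ?_⟩
  · rw [(hf.fderiv_add_eventuallyEq hg hx).eq_of_nhds]
    exact (norm_add_le _ _).trans (add_le_add (hf.norm_fderiv_le x hx) (hg.norm_fderiv_le x hx))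
  · rw [hf.fderiv_fderiv_add hg hx]
    exact (ContinuousLinearMap.opNorm_add_le _ _).trans
      (add_le_add (hf.norm_fderiv_fderiv_le x hx) (hg.norm_fderiv_fderiv_le x hx))

theorem fderiv_const_smul_eventuallyEq (hf : BoundedC2On f U K) (c : ℝ) (hx : x ∈ U) :
    fderiv ℝ (fun y => c • f y) =ᶠ[𝓝 x] fun y => c • fderiv ℝ f y := by
  filter_upwards [hf.isOpen.mem_nhds hx] with y hy
  exact fderiv_fun_const_smul (hf.differentiableAt hy) c

theorem fderiv_fderiv_const_smul (hf : BoundedC2On f U K) (c : ℝ) (hx : x ∈ U) :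
    fderiv ℝ (fderiv ℝ fun y => c • f y) x = c • fderiv ℝ (fderiv ℝ f) x := by
  rw [(hf.fderiv_const_smul_eventuallyEq c hx).fderiv_eq]
  exact fderiv_fun_const_smul (hf.differentiableAt_fderiv hx) c

theorem const_smul (hf : BoundedC2On f U K) (c : ℝ) :
    BoundedC2On (fun y => c • f y) U (|c| * K) := by
  refine ⟨hf.isOpen, contDiffOn_const.smul hf.contDiffOn, fun x hx => ?_, fun x hx => ?_⟩
  · rw [(hf.fderiv_const_smul_eventuallyEq c hx).eq_of_nhds, norm_smul, Real.norm_eq_abs]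
    exact mul_le_mul_of_nonneg_left (hf.norm_fderiv_le x hx) (abs_nonneg c)
  · rw [hf.fderiv_fderiv_const_smul c hx]
    refine (ContinuousLinearMap.opNorm_smul_le c _).trans ?_
    exact mul_le_mul_of_nonneg_left (hf.norm_fderiv_fderiv_le x hx) (abs_nonneg c)

theorem congr (hf : BoundedC2On f U K) (h : Set.EqOn g f U) : BoundedC2On g U K := by
  have h1 : ∀ x ∈ U, g =ᶠ[𝓝 x] f := fun x hx =>
    eventually_of_mem (hf.isOpen.mem_nhds hx) h
  refine ⟨hf.isOpen, hf.contDiffOn.congr h, fun x hx => ?_, fun x hx => ?_⟩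
  · rw [(h1 x hx).fderiv_eq]
    exact hf.norm_fderiv_le x hx
  · rw [(h1 x hx).fderiv.fderiv_eq]
    exact hf.norm_fderiv_fderiv_le x hx

theorem norm_sub_le (hf : BoundedC2On f U K) (hU : Convex ℝ U) (hx : x ∈ U) (hy : y ∈ U) :
    ‖f y - f x‖ ≤ K * ‖y - x‖ :=
  hU.norm_image_sub_le_of_norm_fderiv_le (fun _ hz => hf.differentiableAt hz)
    hf.norm_fderiv_le hx hy

/-- The mean value inequality is applied twice: to the derivative, which is at most `K * ‖y - x‖`
along the segment, and then to `f`. The sharp factor `1/2` is not needed. -/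
theorem norm_sub_le_sq (hf : BoundedC2On f U K) (hU : Convex ℝ U) (hx : x ∈ U) (hy : y ∈ U)
    (h0 : fderiv ℝ f x = 0) : ‖f y - f x‖ ≤ K * ‖y - x‖ ^ 2 := by
  have hsub : segment ℝ x y ⊆ U := hU.segment_subset hx hy
  have h : ∀ z ∈ segment ℝ x y, ‖fderiv ℝ f z‖ ≤ K * ‖y - x‖ := fun z hz => by
    have h1 := hU.norm_image_sub_le_of_norm_fderiv_le
      (fun _ hz => hf.differentiableAt_fderiv hz) hf.norm_fderiv_fderiv_le hx (hsub hz)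
    rw [h0, sub_zero] at h1
    refine h1.trans (mul_le_mul_of_nonneg_left ?_ (hf.nonneg hx))
    obtain ⟨t, ht, rfl⟩ := (segment_eq_image' ℝ x y) ▸ hz
    simp only [add_sub_cancel_left, norm_smul, Real.norm_of_nonneg ht.1]
    exact mul_le_of_le_one_left (norm_nonneg _) ht.2
  have := (convex_segment x y).norm_image_sub_le_of_norm_fderiv_le
    (fun z hz => hf.differentiableAt (hsub hz)) h (left_mem_segment ℝ x y)
    (right_mem_segment ℝ x y)
  rwa [sq, ← mul_assoc]

variable {p : G → E} {B : Set G} {C : ℝ} {θ : G}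

theorem fderiv_comp_eventuallyEq (hf : BoundedC2On f U K) (hp : BoundedC2On p B C)
    (hBU : ∀ θ ∈ B, p θ ∈ U) (hθ : θ ∈ B) :
    fderiv ℝ (fun θ => f (p θ)) =ᶠ[𝓝 θ] fun θ => (fderiv ℝ f (p θ)).comp (fderiv ℝ p θ) := by
  filter_upwards [hp.isOpen.mem_nhds hθ] with y hy
  exact fderiv_fun_comp y (hf.differentiableAt (hBU y hy)) (hp.differentiableAt hy)

theorem fderiv_fderiv_comp_apply (hf : BoundedC2On f U K) (hp : BoundedC2On p B C)
    (hBU : ∀ θ ∈ B, p θ ∈ U) (hθ : θ ∈ B) (v w : G) :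
    fderiv ℝ (fderiv ℝ fun θ => f (p θ)) θ v w =
      fderiv ℝ f (p θ) (fderiv ℝ (fderiv ℝ p) θ v w) +
        fderiv ℝ (fderiv ℝ f) (p θ) (fderiv ℝ p θ v) (fderiv ℝ p θ w) := by
  rw [(hf.fderiv_comp_eventuallyEq hp hBU hθ).fderiv_eq]
  have h1 : HasFDerivAt (fun θ => fderiv ℝ f (p θ))
      ((fderiv ℝ (fderiv ℝ f) (p θ)).comp (fderiv ℝ p θ)) θ :=
    (hf.differentiableAt_fderiv (hBU θ hθ)).hasFDerivAt.comp θ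
      (hp.differentiableAt hθ).hasFDerivAt
  rw [(h1.clm_comp (hp.differentiableAt_fderiv hθ).hasFDerivAt).fderiv]
  simp

/-- The term `K * C` alone bounds the first derivative; for the second, `K * C` comes from the
curvature of `p` and `K * C * C` from that of `f`. -/
theorem comp (hf : BoundedC2On f U K) (hp : BoundedC2On p B C) (hBU : ∀ θ ∈ B, p θ ∈ U) :
    BoundedC2On (fun θ => f (p θ)) B (K * C + K * C * C) := by
  refine ⟨hp.isOpen, hf.contDiffOn.comp hp.contDiffOn hBU, fun x hx => ?_, fun x hx => ?_⟩
  · have hK := hf.nonneg (hBU x hx)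
    have hC := hp.nonneg hx
    rw [(hf.fderiv_comp_eventuallyEq hp hBU hx).eq_of_nhds]
    calc _ ≤ ‖fderiv ℝ f (p x)‖ * ‖fderiv ℝ p x‖ := ContinuousLinearMap.opNorm_comp_le _ _
      _ ≤ K * C := mul_le_mul (hf.norm_fderiv_le _ (hBU x hx)) (hp.norm_fderiv_le _ hx)
          (norm_nonneg _) hK
      _ ≤ _ := le_add_of_nonneg_right (by positivity)
  · have hK := hf.nonneg (hBU x hx)
    have hC := hp.nonneg hx
    refine ContinuousLinearMap.opNorm_le_bound₂ _ (by positivity) fun v w => ?_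
    rw [hf.fderiv_fderiv_comp_apply hp hBU hx, add_mul, add_mul]
    have hv := (fderiv ℝ p x).le_of_opNorm_le (hp.norm_fderiv_le x hx) v
    have hw := (fderiv ℝ p x).le_of_opNorm_le (hp.norm_fderiv_le x hx) w
    refine (norm_add_le _ _).trans (add_le_add ?_ ?_)
    · calc _ ≤ K * (C * ‖v‖ * ‖w‖) :=
            (fderiv ℝ f (p x)).le_of_opNorm_le_of_le (hf.norm_fderiv_le _ (hBU x hx))
              ((fderiv ℝ (fderiv ℝ p) x v).le_of_opNorm_le
                ((fderiv ℝ (fderiv ℝ p) x).le_of_opNorm_le (hp.norm_fderiv_fderiv_le x hx) v) w)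
        _ = _ := by ring
    · calc _ ≤ K * (C * ‖v‖) * (C * ‖w‖) :=
            (fderiv ℝ (fderiv ℝ f) (p x) (fderiv ℝ p x v)).le_of_opNorm_le_of_le
              ((fderiv ℝ (fderiv ℝ f) (p x)).le_of_opNorm_le_of_le
                (hf.norm_fderiv_fderiv_le _ (hBU x hx)) hv) hw
        _ = _ := by ring

end BoundedC2On

/-! ### Taylor expansion along lines, measurable selections, differentiation under the integral. -/

/-- Second-order Taylor expansion along a line, with Peano remainder. -/
theorem tendsto_second_difference {E : Type*} [NormedAddCommGroup E] [NormedSpace ℝ E]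
    {f : E → ℝ} {x : E} (hf : ∀ᶠ y in 𝓝 x, DifferentiableAt ℝ f y)
    (hf' : DifferentiableAt ℝ (fderiv ℝ f) x) (h0 : fderiv ℝ f x = 0) (v : E) :
    Tendsto (fun t : ℝ => (f (x + t • v) - f x) / t ^ 2) (𝓝[≠] 0)
      (𝓝 (fderiv ℝ (fderiv ℝ f) x v v / 2)) := by
  set c := fderiv ℝ (fderiv ℝ f) x v v with hc
  have hline : Tendsto (fun t : ℝ => x + t • v) (𝓝 0) (𝓝 x) := by
    have : Continuous fun t : ℝ => x + t • v := by fun_prop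
    simpa using this.tendsto 0
  have hld : ∀ t : ℝ, HasDerivAt (fun t : ℝ => x + t • v) v t := fun t => by
    simpa using ((hasDerivAt_id t).smul_const v).const_add x
  have hd : ∀ᶠ t : ℝ in 𝓝 0, HasDerivAt (fun t : ℝ => f (x + t • v) - f x - c / 2 * t ^ 2)
      (fderiv ℝ f (x + t • v) v - c * t) t := by
    filter_upwards [hline.eventually hf] with t ht
    have h1 := ht.hasFDerivAt.comp_hasDerivAt t (hld t)
    have h2 := ((hasDerivAt_pow 2 t).const_mul (c / 2))
    refine ((h1.sub_const (f x)).sub h2).congr_deriv ?_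
    norm_num
    ring
  have hd2 : HasDerivAt (fun t : ℝ => fderiv ℝ f (x + t • v) v) c 0 := by
    have h1 : HasFDerivAt (fderiv ℝ f) (fderiv ℝ (fderiv ℝ f) x) (x + (0 : ℝ) • v) := by
      simpa using hf'.hasFDerivAt
    have h2 : HasDerivAt (fun t : ℝ => fderiv ℝ f (x + t • v))
        (fderiv ℝ (fderiv ℝ f) x v) 0 := h1.comp_hasDerivAt (0 : ℝ) (hld 0)
    simpa using h2.clm_apply (hasDerivAt_const (0 : ℝ) v)
  have ho : (fun t : ℝ => fderiv ℝ f (x + t • v) v - c * t) =o[𝓝 0] fun t : ℝ => t := by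
    have := hd2.isLittleO
    simp only [zero_smul, add_zero, h0, sub_zero, zero_apply,
      smul_eq_mul] at this
    simpa [mul_comm] using this
  -- The derivative of this remainder is `o(t)`, so the mean value inequality on the segment from
  -- `0` to `t` makes the remainder `o(t²)`.
  have key : (fun t : ℝ => f (x + t • v) - f x - c / 2 * t ^ 2) =o[𝓝 0] fun t : ℝ => t ^ 2 := by
    rw [isLittleO_iff]
    intro ε hε
    obtain ⟨δ, hδ, hb⟩ := Metric.eventually_nhds_iff_ball.1 (hd.and (isLittleO_iff.1 ho hε))
    filter_upwards [Metric.ball_mem_nhds (0 : ℝ) hδ] with t ht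
    have hsub : segment ℝ 0 t ⊆ Metric.ball (0 : ℝ) δ :=
      (convex_ball _ _).segment_subset (Metric.mem_ball_self hδ) ht
    have := (convex_segment (0 : ℝ) t).norm_image_sub_le_of_norm_hasDerivWithin_le
      (C := ε * ‖t‖) (fun z hz => (hb z (hsub hz)).1.hasDerivWithinAt)
      (fun z hz => (hb z (hsub hz)).2.trans (mul_le_mul_of_nonneg_left ?_ hε.le))
      (left_mem_segment ℝ 0 t) (right_mem_segment ℝ 0 t)
    · simpa [sq, mul_assoc] using this
    · obtain ⟨r, hr, rfl⟩ := (segment_eq_image' ℝ 0 t) ▸ hz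
      simp only [sub_zero, zero_add, norm_smul, Real.norm_of_nonneg hr.1]
      exact mul_le_of_le_one_left (norm_nonneg _) hr.2
  have h := (key.mono nhdsWithin_le_nhds (l := 𝓝[≠] 0)).tendsto_div_nhds_zero.add_const (c / 2)
  rw [zero_add] at h
  refine h.congr' ?_
  filter_upwards [self_mem_nhdsWithin] with t ht
  have ht : t ≠ 0 := ht
  field_simp
  ring

/-- Directional derivatives along a measurable selection depend measurably on the parameter. -/
theorem measurable_fderiv_selection {X E : Type*} [MeasurableSpace X]
    [NormedAddCommGroup E] [NormedSpace ℝ E] [SecondCountableTopology E] [MeasurableSpace E]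
    [BorelSpace E] {F : Type*} [NormedAddCommGroup F] [NormedSpace ℝ F]
    [SecondCountableTopology F] [MeasurableSpace F] [BorelSpace F]
    {f : X → E → F} {U : Set E} (hU : IsOpen U)
    (hf : ∀ a : X → E, Measurable a → (∀ x, a x ∈ U) → Measurable fun x => f x (a x))
    (hd : ∀ x, ∀ y ∈ U, DifferentiableAt ℝ (f x) y)
    {a : X → E} (ha : Measurable a) (haU : ∀ x, a x ∈ U) (v : E) :
    Measurable fun x => fderiv ℝ (f x) (a x) v := by
  classical
  let c : ℕ → ℝ := fun n => n + 1
  have hc : Tendsto (fun n => ‖c n‖) atTop atTop := by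
    have h : Tendsto c atTop atTop :=
      tendsto_atTop_add_const_right _ _ tendsto_natCast_atTop_atTop
    exact tendsto_norm_atTop_atTop.comp h
  -- The derivative is a pointwise limit of difference quotients. Steps that would leave `U` are
  -- replaced by no step at all; for each `x` this happens only finitely often.
  let b : ℕ → X → E := fun n x => if a x + (c n)⁻¹ • v ∈ U then a x + (c n)⁻¹ • v else a x
  have hb : ∀ n, Measurable (b n) := fun n =>
    Measurable.ite ((ha.add_const _) hU.measurableSet) (ha.add_const _) ha
  have hbU : ∀ n x, b n x ∈ U := fun n x => by
    by_cases h : a x + (c n)⁻¹ • v ∈ U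
    · simpa only [b, if_pos h] using h
    · simpa only [b, if_neg h] using haU x
  refine measurable_of_tendsto_metrizable
    (f := fun n x => c n • (f x (b n x) - f x (a x)))
    (fun n => ((hf _ (hb n) (hbU n)).sub (hf _ ha haU)).const_smul _) ?_
  refine tendsto_pi_nhds.2 fun x => ?_
  refine ((hd x _ (haU x)).hasFDerivAt.lim v hc).congr' ?_
  have hlim : Tendsto (fun n => a x + (c n)⁻¹ • v) atTop (𝓝 (a x)) := by
    have h1 : Tendsto (fun n => (c n)⁻¹) atTop (𝓝 0) :=
      tendsto_inv_atTop_zero.comp (tendsto_atTop_add_const_right _ _ tendsto_natCast_atTop_atTop)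
    simpa using (h1.smul_const v).const_add (a x)
  filter_upwards [hlim.eventually (hU.mem_nhds (haU x))] with n hn
  have hn : a x + (c n)⁻¹ • v ∈ U := hn
  simp only [b, if_pos hn]

/-- The domain is finite-dimensional, so `T x` is a finite sum of rank-one operators built
continuously from its values on the basis. -/
theorem stronglyMeasurable_clm {X F : Type*} [MeasurableSpace X] {m : ℕ}
    [NormedAddCommGroup F] [NormedSpace ℝ F] {T : X → EuclideanSpace ℝ (Fin m) →L[ℝ] F}
    (hT : ∀ i, StronglyMeasurable fun x => T x (EuclideanSpace.single i 1)) :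
    StronglyMeasurable T := by
  have h : T = fun x => ∑ i, ContinuousLinearMap.smulRightL ℝ (EuclideanSpace ℝ (Fin m)) F
      (EuclideanSpace.proj i) (T x (EuclideanSpace.single i 1)) := by
    funext x
    ext v
    conv_lhs => rw [← (EuclideanSpace.basisFun (Fin m) ℝ).sum_repr v]
    simp [map_sum]
  rw [h]
  exact Finset.stronglyMeasurable_fun_sum _ fun i _ =>
    (ContinuousLinearMap.continuous _).comp_stronglyMeasurable (hT i)

section BoundedWeight

variable {X E V : Type*} [MeasurableSpace X] {ν : Measure X} [NormedAddCommGroup E]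
  [NormedAddCommGroup V] [NormedSpace ℝ V] {g h : X → ℝ} {C G : ℝ}

theorem MeasurableBoundedBy.norm_smul_le (hg : MeasurableBoundedBy g G) (hG : 0 ≤ G) {x : X}
    {w : V} {c : ℝ} (hw : ‖w‖ ≤ c) : ‖g x • w‖ ≤ G * c := by
  rw [norm_smul]
  exact mul_le_mul (hg.abs_le x) hw (norm_nonneg _) hG

theorem MeasurableBoundedBy.aestronglyMeasurable_smul (hg : MeasurableBoundedBy g G)
    {ψ : X → V} (hψ : AEStronglyMeasurable ψ ν) : AEStronglyMeasurable (fun x => g x • ψ x) ν :=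
  hg.measurable.aestronglyMeasurable.smul hψ

theorem MeasurableBoundedBy.integrable_smul (hg : MeasurableBoundedBy g G) (hG : 0 ≤ G)
    {ψ : X → V} (hψ : AEStronglyMeasurable ψ ν) (hh : Integrable h ν) (hb : ∀ x, ‖ψ x‖ ≤ h x) :
    Integrable (fun x => g x • ψ x) ν :=
  (hh.const_mul G).mono' (hg.aestronglyMeasurable_smul hψ)
    (Eventually.of_forall fun x => hg.norm_smul_le hG (hb x))

theorem MeasurableBoundedBy.norm_integral_smul_le (hg : MeasurableBoundedBy g G) (hG : 0 ≤ G)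
    {ψ : X → V} (hh : Integrable h ν) (hb : ∀ x, ‖ψ x‖ ≤ h x) (hC : ∫ x, h x ∂ν ≤ C) :
    ‖∫ x, g x • ψ x ∂ν‖ ≤ G * C := by
  refine (norm_integral_le_of_norm_le (hh.const_mul G) (Eventually.of_forall fun x =>
    hg.norm_smul_le hG (hb x))).trans ?_
  rw [integral_const_mul]
  exact mul_le_mul_of_nonneg_left hC hG

theorem MeasurableBoundedBy.continuousAt_integral_smul (hg : MeasurableBoundedBy g G)
    (hG : 0 ≤ G) {ψ : X → E → V} {a : E}
    (hψ : ∀ᶠ b in 𝓝 a, AEStronglyMeasurable (fun x => ψ x b) ν) (hh : Integrable h ν)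
    (hb : ∀ᶠ b in 𝓝 a, ∀ x, ‖ψ x b‖ ≤ h x) (hc : ∀ x, ContinuousAt (ψ x) a) :
    ContinuousAt (fun b => ∫ x, g x • ψ x b ∂ν) a :=
  continuousAt_of_dominated (bound := fun x => G * h x)
    (hψ.mono fun _ hb => hg.aestronglyMeasurable_smul hb)
    (hb.mono fun _ hb => Eventually.of_forall fun x => hg.norm_smul_le hG (hb x))
    (hh.const_mul G) (Eventually.of_forall fun x => (hc x).const_smul (g x))

theorem MeasurableBoundedBy.hasFDerivAt_integral_smul [NormedSpace ℝ E]
    (hg : MeasurableBoundedBy g G) (hG : 0 ≤ G) {φ : X → E → V} {a : E}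
    (hφ : ∀ᶠ b in 𝓝 a, AEStronglyMeasurable (fun x => φ x b) ν)
    (hi : Integrable (fun x => g x • φ x a) ν)
    (hφ' : AEStronglyMeasurable (fun x => fderiv ℝ (φ x) a) ν)
    (hh : Integrable h ν) (hb : ∀ᶠ b in 𝓝 a, ∀ x, ‖fderiv ℝ (φ x) b‖ ≤ h x)
    (hd : ∀ᶠ b in 𝓝 a, ∀ x, DifferentiableAt ℝ (φ x) b) :
    HasFDerivAt (fun b => ∫ x, g x • φ x b ∂ν) (∫ x, g x • fderiv ℝ (φ x) a ∂ν) a :=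
  hasFDerivAt_integral_of_dominated_of_fderiv_le
    (F' := fun b x => g x • fderiv ℝ (φ x) b) (bound := fun x => G * h x)
    (hb.and hd) (hφ.mono fun _ hb => hg.aestronglyMeasurable_smul hb) hi
    (hg.aestronglyMeasurable_smul hφ')
    (Eventually.of_forall fun _ _ hx => hg.norm_smul_le hG (hx.1 _)) (hh.const_mul G)
    (Eventually.of_forall fun x _ hx => (hx.2 x).hasFDerivAt.const_smul (g x))

end BoundedWeight

/-- Integration of a parametrized family of `C²` functions against a bounded weight. -/
theorem BoundedC2On.integral {X : Type*} [MeasurableSpace X] {ν : Measure X} {m : ℕ}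
    {ρ : X → EuclideanSpace ℝ (Fin m) → ℝ} {U : Set (EuclideanSpace ℝ (Fin m))} {C G : ℝ}
    (hU : IsOpen U) (hm : ∀ a : X → EuclideanSpace ℝ (Fin m), Measurable a →
      Measurable fun x => ρ x (a x)) (h2 : ∀ x, ContDiffOn ℝ 2 (ρ x) U)
    (hi : ∀ a ∈ U, Integrable (fun x => ρ x a) ν)
    (hdom : ∀ a ∈ U, ∃ h : X → ℝ, Integrable h ν ∧ ∫ x, h x ∂ν ≤ C ∧
      ∀ᶠ b in 𝓝 a, ∀ x, ‖fderiv ℝ (ρ x) b‖ ≤ h x ∧ ‖fderiv ℝ (fderiv ℝ (ρ x)) b‖ ≤ h x)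
    {g : X → ℝ} (hg : MeasurableBoundedBy g G) (hG : 0 ≤ G) :
    BoundedC2On (fun a => ∫ x, g x • ρ x a ∂ν) U (G * C) := by
  have hca : ∀ x, ∀ a ∈ U, ContDiffAt ℝ 2 (ρ x) a := fun x a ha =>
    (h2 x).contDiffAt (hU.mem_nhds ha)
  have hd1 : ∀ x, ∀ a ∈ U, DifferentiableAt ℝ (ρ x) a := fun x a ha =>
    (hca x a ha).differentiableAt (by norm_num)
  have hcf : ∀ x, ∀ a ∈ U, ContDiffAt ℝ 1 (fderiv ℝ (ρ x)) a := fun x a ha =>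
    (hca x a ha).fderiv_right (by norm_num)
  have hd2 : ∀ x, ∀ a ∈ U, DifferentiableAt ℝ (fderiv ℝ (ρ x)) a := fun x a ha =>
    (hcf x a ha).differentiableAt (by norm_num)
  have hc2 : ∀ x, ∀ a ∈ U, ContinuousAt (fderiv ℝ (fderiv ℝ (ρ x))) a := fun x a ha =>
    ((hcf x a ha).fderiv_right (m := 0) (by norm_num)).continuousAt
  have hm1 : ∀ v, ∀ a : X → EuclideanSpace ℝ (Fin m), Measurable a → (∀ x, a x ∈ U) →
      Measurable fun x => fderiv ℝ (ρ x) (a x) v := fun v a ha haU =>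
    measurable_fderiv_selection hU (fun a ha _ => hm a ha) hd1 ha haU v
  have hfv : ∀ w x, ∀ y ∈ U, HasFDerivAt (fun y => fderiv ℝ (ρ x) y w)
      ((fderiv ℝ (fderiv ℝ (ρ x)) y).flip w) y := fun w x y hy => by
    have := (hd2 x y hy).hasFDerivAt.clm_apply (hasFDerivAt_const w y)
    simpa using this
  -- The selection lemma is used a second time, on the function `y ↦ fderiv ℝ (ρ x) y w`, whose own
  -- measurability along selections is `hm1`.
  have hm2 : ∀ v w, ∀ a ∈ U, Measurable fun x => fderiv ℝ (fderiv ℝ (ρ x)) a v w :=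
    fun v w a ha => by
      have := measurable_fderiv_selection hU (hm1 w) (fun x y hy => (hfv w x y hy).differentiableAt)
        (measurable_const (a := a)) (fun _ => ha) v
      simpa only [(hfv w _ a ha).fderiv, ContinuousLinearMap.flip_apply] using this
  have hs0 : ∀ a, AEStronglyMeasurable (fun x => ρ x a) ν := fun a =>
    (hm (fun _ => a) measurable_const).aestronglyMeasurable
  have hs1 : ∀ a ∈ U, AEStronglyMeasurable (fun x => fderiv ℝ (ρ x) a) ν := fun a ha =>
    (stronglyMeasurable_clm fun i =>
      (hm1 _ _ measurable_const fun _ => ha).stronglyMeasurable).aestronglyMeasurable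
  have hs2 : ∀ a ∈ U, AEStronglyMeasurable (fun x => fderiv ℝ (fderiv ℝ (ρ x)) a) ν :=
    fun a ha => (stronglyMeasurable_clm fun i =>
      stronglyMeasurable_clm fun j => (hm2 _ _ a ha).stronglyMeasurable).aestronglyMeasurable
  have hF1 : ∀ a ∈ U, Integrable (fun x => g x • fderiv ℝ (ρ x) a) ν ∧
      HasFDerivAt (fun a => ∫ x, g x • ρ x a ∂ν) (∫ x, g x • fderiv ℝ (ρ x) a ∂ν) a ∧
      ‖∫ x, g x • fderiv ℝ (ρ x) a ∂ν‖ ≤ G * C := by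
    intro a ha
    obtain ⟨h, hh, hC, hb⟩ := hdom a ha
    have hb0 := hb.self_of_nhds
    exact ⟨hg.integrable_smul hG (hs1 a ha) hh fun x => (hb0 x).1,
      hg.hasFDerivAt_integral_smul hG (Eventually.of_forall hs0)
        (hg.integrable_smul hG (hs0 a) (hi a ha).norm fun _ => le_rfl) (hs1 a ha) hh
        (hb.mono fun _ hb x => (hb x).1)
        (eventually_of_mem (hU.mem_nhds ha) fun b hb x => hd1 x b hb),
      hg.norm_integral_smul_le hG hh (fun x => (hb0 x).1) hC⟩
  have hF2 : ∀ a ∈ U,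
      HasFDerivAt (fun a => ∫ x, g x • fderiv ℝ (ρ x) a ∂ν)
        (∫ x, g x • fderiv ℝ (fderiv ℝ (ρ x)) a ∂ν) a ∧
      ‖∫ x, g x • fderiv ℝ (fderiv ℝ (ρ x)) a ∂ν‖ ≤ G * C ∧
      ContinuousAt (fun a => ∫ x, g x • fderiv ℝ (fderiv ℝ (ρ x)) a ∂ν) a := by
    intro a ha
    obtain ⟨h, hh, hC, hb⟩ := hdom a ha
    have hb0 := hb.self_of_nhds
    exact ⟨hg.hasFDerivAt_integral_smul hG (eventually_of_mem (hU.mem_nhds ha) hs1) (hF1 a ha).1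
        (hs2 a ha) hh (hb.mono fun _ hb x => (hb x).2)
        (eventually_of_mem (hU.mem_nhds ha) fun b hb x => hd2 x b hb),
      hg.norm_integral_smul_le hG hh (fun x => (hb0 x).2) hC,
      hg.continuousAt_integral_smul hG (eventually_of_mem (hU.mem_nhds ha) hs2) hh
        (hb.mono fun _ hb x => (hb x).2) fun x => hc2 x a ha⟩
  have he1 : ∀ a ∈ U, fderiv ℝ (fun a => ∫ x, g x • ρ x a ∂ν) =ᶠ[𝓝 a]
      fun a => ∫ x, g x • fderiv ℝ (ρ x) a ∂ν := fun a ha =>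
    eventually_of_mem (hU.mem_nhds ha) fun b hb => (hF1 b hb).2.1.fderiv
  have he2 : ∀ a ∈ U, fderiv ℝ (fderiv ℝ fun a => ∫ x, g x • ρ x a ∂ν) a =
      ∫ x, g x • fderiv ℝ (fderiv ℝ (ρ x)) a ∂ν := fun a ha => by
    rw [(he1 a ha).fderiv_eq, (hF2 a ha).1.fderiv]
  refine BoundedC2On.of_differentiableAt hU (fun a ha => (hF1 a ha).2.1.differentiableAt)
    (fun a ha => ((he1 a ha).differentiableAt_iff).2 (hF2 a ha).1.differentiableAt)
    (fun a ha => (hF2 a ha).2.2.congr (eventually_of_mem (hU.mem_nhds ha)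
      fun b hb => (he2 b hb).symm))
    (fun a ha => ?_) (fun a ha => ?_)
  · rw [(he1 a ha).eq_of_nhds]
    exact (hF1 a ha).2.2
  · rw [he2 a ha]
    exact (hF2 a ha).2.1

/-! ### Regularity of `Q` and first-order optimality in the action. -/

namespace MDP

variable {S : Type*} [MeasurableSpace S] {ν : Measure S} {m : ℕ}

/-- Regularity of the data with a nonnegative bound `C`, the density being tested against bounded
functions. -/
structure RegularWith (M : MDP S ν m) (C : ℝ) : Prop where
  nonneg : 0 ≤ C
  abs_R_le : ∀ s, ∀ a ∈ M.A, |M.R s a| ≤ C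
  boundedC2On_R : ∀ s, BoundedC2On (M.R s) (interior M.A) C
  boundedC2On_transition : ∀ s {g : S → ℝ} {G : ℝ}, MeasurableBoundedBy g G → 0 ≤ G →
    BoundedC2On (fun a => ∫ x, g x ∂M.transition s a) (interior M.A) (G * C)

theorem integrable_density (M : MDP S ν m) (s : S) {a : EuclideanSpace ℝ (Fin m)} (ha : a ∈ M.A) :
    Integrable (M.density s a) ν := by
  refine ⟨(M.measurable_density_right s a).aestronglyMeasurable, ?_⟩
  rw [hasFiniteIntegral_iff_ofReal (Eventually.of_forall (M.density_nonneg s a ha)),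
    M.lintegral_density s a ha]
  exact ENNReal.one_lt_top

theorem IsRegular.exists_regularWith {M : MDP S ν m} (hM : M.IsRegular) :
    ∃ C, M.RegularWith C := by
  obtain ⟨C, hR, hR2, hRb, hd2, hdb⟩ := hM
  refine ⟨|C|, abs_nonneg C, fun s a ha => (hR s a ha).trans (le_abs_self C), fun s =>
    ⟨isOpen_interior, hR2 s, fun a ha => ((hRb s a ha).1).trans (le_abs_self C),
      fun a ha => ((hRb s a ha).2).trans (le_abs_self C)⟩, fun s g G hg hG => ?_⟩
  refine (BoundedC2On.integral (ρ := fun x a => M.density s a x) (g := g) isOpen_interior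
    (fun a ha => M.measurable_density.comp ((measurable_const.prodMk ha).prodMk measurable_id))
    (hd2 s) (fun a ha => M.integrable_density s (interior_subset ha)) (fun a ha => ?_)
    hg hG).congr fun a ha => ?_
  · obtain ⟨h, hh, hC, hb⟩ := hdb s a ha
    exact ⟨h, hh, hC.trans (le_abs_self C), hb⟩
  · simp only [integral_transition]
    refine integral_congr_ae (Eventually.of_forall fun x => ?_)
    simp only [max_eq_left (M.density_nonneg s a (interior_subset ha) x), smul_eq_mul]
    ring

theorem RegularWith.div_nonneg {M : MDP S ν m} {C : ℝ} (hM : M.RegularWith C) : 0 ≤ C / (1 - M.γ) :=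
  _root_.div_nonneg hM.nonneg (sub_nonneg.2 M.γ_lt_one.le)

section

variable [SigmaFinite ν] {M : MDP S ν m} {C : ℝ}

theorem RegularWith.measurableBoundedBy_V (hM : M.RegularWith C)
    {π : S → EuclideanSpace ℝ (Fin m)} (hπ : M.IsPolicy π) :
    MeasurableBoundedBy (M.V π) (C / (1 - M.γ)) :=
  MDP.measurableBoundedBy_V hM.abs_R_le hπ

/-- In `Q^π` the action enters only through the reward and the density; `V^π` is a fixed bounded
weight, so no regularity of `V^π` in the state is needed and the bound is uniform in the policy. -/
theorem RegularWith.boundedC2On_Q (hM : M.RegularWith C)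
    {π : S → EuclideanSpace ℝ (Fin m)} (hπ : M.IsPolicy π) (s : S) :
    BoundedC2On (M.Q π s) (interior M.A) (C + |M.γ| * (C / (1 - M.γ) * C)) :=
  (hM.boundedC2On_R s).add
    ((hM.boundedC2On_transition s (hM.measurableBoundedBy_V hπ) hM.div_nonneg).const_smul M.γ)

/-- The rewards cancel: near `a` the two action-value functions differ by `γ` times the expectation
of `V^π - V^π'`, a weight bounded by `c`. -/
theorem RegularWith.norm_fderiv_fderiv_Q_sub_le (hM : M.RegularWith C)
    {π π' : S → EuclideanSpace ℝ (Fin m)} (hπ : M.IsPolicy π) (hπ' : M.IsPolicy π') {c : ℝ}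
    (hc : 0 ≤ c) (hV : ∀ s, |M.V π s - M.V π' s| ≤ c) (s : S) {a : EuclideanSpace ℝ (Fin m)}
    (ha : a ∈ interior M.A) :
    ‖fderiv ℝ (fderiv ℝ (M.Q π s)) a - fderiv ℝ (fderiv ℝ (M.Q π' s)) a‖ ≤ c * C := by
  have hV1 := hM.measurableBoundedBy_V hπ
  have hV2 := hM.measurableBoundedBy_V hπ'
  have hVd : MeasurableBoundedBy (fun s => M.V π s - M.V π' s) c := ⟨(hV1.sub hV2).measurable, hV⟩
  have hQ' := hM.boundedC2On_Q hπ' s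
  have hd := (hM.boundedC2On_transition s hVd hc).const_smul M.γ
  have he : M.Q π s =ᶠ[𝓝 a] fun b => M.Q π' s b +
      M.γ • ∫ x, (M.V π x - M.V π' x) ∂M.transition s b := by
    filter_upwards [isOpen_interior.mem_nhds ha] with b hb
    have := M.isProbabilityMeasure_transition s (interior_subset hb)
    rw [integral_sub (hV1.integrable _) (hV2.integrable _)]
    simp only [Q, smul_eq_mul]
    ring
  rw [he.fderiv.fderiv_eq, hQ'.fderiv_fderiv_add hd ha, add_sub_cancel_left]
  refine (hd.norm_fderiv_fderiv_le a ha).trans ?_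
  rw [abs_of_pos M.γ_pos]
  exact mul_le_of_le_one_left (mul_nonneg hc hM.nonneg) M.γ_lt_one.le

/-- Directional derivatives of `Q^π` at the actions of `π` do not exceed zero where `π` is
uniquely optimal. -/
theorem RegularWith.ae_fderiv_Q_apply_nonpos (hM : M.RegularWith C)
    {π : S → EuclideanSpace ℝ (Fin m)} (hπ : M.IsUniqueOptimal π)
    (hin : ∀ s, π s ∈ interior M.A) (v : EuclideanSpace ℝ (Fin m)) :
    ∀ᵐ s ∂M.visitation π, fderiv ℝ (M.Q π s) (π s) v ≤ 0 := by
  classical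
  have hpol := hπ.1.1
  have hR := hM.abs_R_le
  let c : ℕ → ℝ := fun n => n + 1
  have hc0 : ∀ n, 0 < c n := fun n => by positivity
  have hcl : Tendsto c atTop atTop :=
    tendsto_atTop_add_const_right _ _ tendsto_natCast_atTop_atTop
  let b : ℕ → S → EuclideanSpace ℝ (Fin m) := fun n s => π s + (c n)⁻¹ • v
  have hbm : ∀ n, Measurable (b n) := fun n => hpol.1.add_const _
  -- `N n` collects the states where the step `v / (n + 1)` strictly improves on `π`, and `π' n`
  -- takes that step exactly there. Its advantage is nonnegative everywhere, so it is optimal by the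
  -- performance difference identity.
  let N : ℕ → Set S := fun n => {s | b n s ∈ interior M.A ∧ M.V π s < M.Q π s (b n s)}
  have hNm : ∀ n, MeasurableSet (N n) := fun n =>
    (hbm n isOpen_interior.measurableSet).inter (measurableSet_lt
      (hM.measurableBoundedBy_V hpol).measurable
      ((measurable_Q hR hpol).comp (f := fun s => (s, b n s)) (measurable_id.prodMk (hbm n))))
  let π' : ℕ → S → EuclideanSpace ℝ (Fin m) := fun n s => if s ∈ N n then b n s else π s
  have hπ' : ∀ n, M.IsPolicy (π' n) := fun n => by
    refine ⟨Measurable.ite (hNm n) (hbm n) hpol.1, fun s => ?_⟩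
    by_cases hs : s ∈ N n
    · simpa only [π', if_pos hs] using interior_subset hs.1
    · simpa only [π', if_neg hs] using hpol.2 s
  have hadv : ∀ n s, 0 ≤ M.Q π s (π' n s) - M.V π s := fun n s => by
    by_cases hs : s ∈ N n
    · simpa only [π', if_pos hs, sub_nonneg] using hs.2.le
    · simp only [π', if_neg hs, ← V_eq_Q hR hpol, sub_self, le_refl]
  have hopt : ∀ n, M.IsOptimal (π' n) := fun n => by
    refine ⟨hπ' n, fun π'' h'' => (hπ.1.2 π'' h'').trans ?_⟩
    rw [← sub_nonneg, J_sub_J hR hpol (hπ' n)]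
    exact integral_nonneg (hadv n)
  -- Uniqueness forces `π' n = π` almost everywhere, but on `N n` the two actions have different
  -- `Q`-values; so `N n` is null.
  have hnot : ∀ᵐ s ∂M.visitation π, ∀ n, s ∉ N n := by
    refine ae_all_iff.2 fun n => ?_
    filter_upwards [hπ.2 _ (hopt n)] with s hs hsN
    have h1 : b n s = π s := by simpa only [π', if_pos hsN] using hs
    have h2 := hsN.2
    rw [h1, ← V_eq_Q hR hpol] at h2
    exact lt_irrefl _ h2
  filter_upwards [hnot] with s hs
  have hlim := ((hM.boundedC2On_Q hpol s).differentiableAt (hin s)).hasFDerivAt.lim v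
    (tendsto_norm_atTop_atTop.comp hcl)
  refine le_of_tendsto hlim ?_
  have hbl : Tendsto (fun n => b n s) atTop (𝓝 (π s)) := by
    simpa [b] using ((tendsto_inv_atTop_zero.comp hcl).smul_const v).const_add (π s)
  filter_upwards [hbl.eventually (isOpen_interior.mem_nhds (hin s))] with n hn
  have h1 : M.Q π s (b n s) ≤ M.V π s := not_lt.1 fun h => hs n ⟨hn, h⟩
  rw [V_eq_Q hR hpol] at h1
  exact mul_nonpos_of_nonneg_of_nonpos (hc0 n).le (sub_nonpos.2 h1)

theorem RegularWith.measurable_fderiv_Q (hM : M.RegularWith C)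
    {π : S → EuclideanSpace ℝ (Fin m)} (hπ : M.IsPolicy π)
    {a : S → EuclideanSpace ℝ (Fin m)} (ha : Measurable a) (hin : ∀ s, a s ∈ interior M.A)
    (v : EuclideanSpace ℝ (Fin m)) :
    Measurable fun s => fderiv ℝ (M.Q π s) (a s) v :=
  measurable_fderiv_selection isOpen_interior
    (fun b hb _ => (measurable_Q hM.abs_R_le hπ).comp (f := fun s => (s, b s))
      (measurable_id.prodMk hb))
    (fun s _ hy => (hM.boundedC2On_Q hπ s).differentiableAt hy) ha hin v

theorem RegularWith.stronglyMeasurable_fderiv_fderiv_Q (hM : M.RegularWith C)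
    {π : S → EuclideanSpace ℝ (Fin m)} (hπ : M.IsPolicy π)
    {a : S → EuclideanSpace ℝ (Fin m)} (ha : Measurable a) (hin : ∀ s, a s ∈ interior M.A) :
    StronglyMeasurable fun s => fderiv ℝ (fderiv ℝ (M.Q π s)) (a s) := by
  refine stronglyMeasurable_clm fun i => stronglyMeasurable_clm fun j => ?_
  have hw : ∀ s, ∀ y ∈ interior M.A,
      HasFDerivAt (fun y => fderiv ℝ (M.Q π s) y (EuclideanSpace.single j 1))
        ((fderiv ℝ (fderiv ℝ (M.Q π s)) y).flip (EuclideanSpace.single j 1)) y := fun s y hy => by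
    simpa using ((hM.boundedC2On_Q hπ s).differentiableAt_fderiv hy).hasFDerivAt.clm_apply
      (hasFDerivAt_const (EuclideanSpace.single j (1 : ℝ)) y)
  have := measurable_fderiv_selection isOpen_interior
    (fun b hb hbin => hM.measurable_fderiv_Q hπ hb hbin (EuclideanSpace.single j 1))
    (fun s y hy => (hw s y hy).differentiableAt) ha hin (EuclideanSpace.single i 1)
  simpa only [(hw _ _ (hin _)).fderiv, ContinuousLinearMap.flip_apply]
    using this.stronglyMeasurable

/-- At a uniquely optimal policy with interior actions, the action gradient of `Q` vanishes up to
a set of states that is never encountered. -/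
theorem RegularWith.exists_null_fderiv_Q_eq_zero (hM : M.RegularWith C)
    {π : S → EuclideanSpace ℝ (Fin m)} (hπ : M.IsUniqueOptimal π)
    (hin : ∀ s, π s ∈ interior M.A) :
    ∃ N : Set S, MeasurableSet N ∧ (∀ i, M.stateLaw π M.init i N = 0) ∧
      ∀ s ∉ N, fderiv ℝ (M.Q π s) (π s) = 0 := by
  have hsm : StronglyMeasurable fun s => fderiv ℝ (M.Q π s) (π s) :=
    stronglyMeasurable_clm fun i =>
      (hM.measurable_fderiv_Q hπ.1.1 hπ.1.1.1 hin _).stronglyMeasurable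
  refine ⟨{s | fderiv ℝ (M.Q π s) (π s) = 0}ᶜ,
    (hsm.measurableSet_eq_fun stronglyMeasurable_const).compl, ?_, fun s hs => not_not.1 hs⟩
  have h : ∀ᵐ s ∂M.visitation π, fderiv ℝ (M.Q π s) (π s) = 0 := by
    -- Applying the one-sided inequality to both signs of each basis vector gives equality to zero;
    -- only finitely many null sets are involved.
    have h1 := ae_all_iff.2 fun i : Fin m =>
      hM.ae_fderiv_Q_apply_nonpos hπ hin (EuclideanSpace.single i 1)
    have h2 := ae_all_iff.2 fun i : Fin m =>
      hM.ae_fderiv_Q_apply_nonpos hπ hin (-EuclideanSpace.single i 1)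
    filter_upwards [h1, h2] with s hs1 hs2
    ext v
    rw [← (EuclideanSpace.basisFun (Fin m) ℝ).sum_repr v, map_sum]
    refine (Finset.sum_eq_zero fun i _ => ?_).trans rfl
    have hz : fderiv ℝ (M.Q π s) (π s) (EuclideanSpace.single i 1) = 0 :=
      le_antisymm (hs1 i) (by simpa using hs2 i)
    simp [hz]
  exact fun i => ae_iff.1 (ae_visitation_iff.1 h i)

end

end MDP

/-! ### Dependence of state laws and values on the policy parameter. -/

namespace MDP

variable {S : Type*} [MeasurableSpace S] {ν : Measure S} {m n : ℕ}

/-- A family of policies that near `θ₀` is `C²` in the parameter, with interior actions and with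
derivatives bounded by `D`. -/
structure SmoothFamily (M : MDP S ν m)
    (π : EuclideanSpace ℝ (Fin n) → S → EuclideanSpace ℝ (Fin m))
    (θ₀ : EuclideanSpace ℝ (Fin n)) (r D : ℝ) : Prop where
  isPolicy : ∀ θ, M.IsPolicy (π θ)
  pos : 0 < r
  nonneg : 0 ≤ D
  boundedC2On : ∀ s, BoundedC2On (fun θ => π θ s) (Metric.ball θ₀ r) D
  mem_interior : ∀ s, ∀ θ ∈ Metric.ball θ₀ r, π θ s ∈ interior M.A

theorem IsRegularPolicyNear.exists_smoothFamily {M : MDP S ν m}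
    {π : EuclideanSpace ℝ (Fin n) → S → EuclideanSpace ℝ (Fin m)}
    {θ₀ : EuclideanSpace ℝ (Fin n)} (h : M.IsRegularPolicyNear π θ₀)
    (hπ : ∀ θ, M.IsPolicy (π θ)) : ∃ r D, M.SmoothFamily π θ₀ r D := by
  obtain ⟨D, r, hr, h⟩ := h
  exact ⟨r, |D|, hπ, hr, abs_nonneg D, fun s => ⟨Metric.isOpen_ball, (h s).1,
    fun θ hθ => ((h s).2 θ hθ).2.1.trans (le_abs_self D),
    fun θ hθ => ((h s).2 θ hθ).2.2.trans (le_abs_self D)⟩, fun s θ hθ => ((h s).2 θ hθ).1⟩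

section

variable {M : MDP S ν m} {C r D : ℝ}
  {π : EuclideanSpace ℝ (Fin n) → S → EuclideanSpace ℝ (Fin m)}
  {θ₀ θ : EuclideanSpace ℝ (Fin n)}

theorem SmoothFamily.mem_ball (hF : M.SmoothFamily π θ₀ r D) : θ₀ ∈ Metric.ball θ₀ r :=
  Metric.mem_ball_self hF.pos

theorem SmoothFamily.comp (hF : M.SmoothFamily π θ₀ r D) {f : EuclideanSpace ℝ (Fin m) → ℝ}
    {K : ℝ} (hf : BoundedC2On f (interior M.A) K) (s : S) :
    BoundedC2On (fun θ => f (π θ s)) (Metric.ball θ₀ r) (K * (D + D * D)) := by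
  have h := hf.comp (hF.boundedC2On s) (hF.mem_interior s)
  rwa [show K * D + K * D * D = K * (D + D * D) by ring] at h

/-- Here the difference quotients need no truncation to the ball, since `π θ` is measurable for
every parameter. -/
theorem SmoothFamily.measurable_fderiv (hF : M.SmoothFamily π θ₀ r D)
    (hθ : θ ∈ Metric.ball θ₀ r) (v : EuclideanSpace ℝ (Fin n)) :
    Measurable fun s => fderiv ℝ (fun θ => π θ s) θ v := by
  let c : ℕ → ℝ := fun k => k + 1
  have hc : Tendsto (fun k => ‖c k‖) atTop atTop := tendsto_norm_atTop_atTop.comp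
    (tendsto_atTop_add_const_right _ _ tendsto_natCast_atTop_atTop)
  refine measurable_of_tendsto_metrizable
    (f := fun k s => c k • (π (θ + (c k)⁻¹ • v) s - π θ s))
    (fun k => ((hF.isPolicy (θ + (c k)⁻¹ • v)).1.sub (hF.isPolicy θ).1).const_smul (c k)) ?_
  exact tendsto_pi_nhds.2 fun s =>
    ((hF.boundedC2On s).differentiableAt hθ).hasFDerivAt.lim v hc

theorem SmoothFamily.abs_integral_transition_sub_le (hF : M.SmoothFamily π θ₀ r D)
    (hM : M.RegularWith C) (hθ : θ ∈ Metric.ball θ₀ r) {g : S → ℝ} {G : ℝ}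
    (hg : MeasurableBoundedBy g G) (hG : 0 ≤ G) (s : S) :
    |∫ x, g x ∂M.transition s (π θ s) - ∫ x, g x ∂M.transition s (π θ₀ s)| ≤
      G * (C * (D + D * D) * ‖θ - θ₀‖) := by
  have h := (hF.comp (hM.boundedC2On_transition s hg hG) s).norm_sub_le (convex_ball _ _)
    hF.mem_ball hθ
  rw [Real.norm_eq_abs] at h
  exact h.trans (le_of_eq (by ring))

theorem summable_pow_mul_natCast (M : MDP S ν m) : Summable fun i : ℕ => M.γ ^ i * (i : ℝ) := by
  have := summable_pow_mul_geometric_of_norm_lt_one 1 (r := M.γ)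
    (by rw [Real.norm_of_nonneg M.γ_pos.le]; exact M.γ_lt_one)
  simpa [mul_comm] using this

theorem tsum_pow_mul_natCast_nonneg (M : MDP S ν m) : 0 ≤ ∑' i : ℕ, M.γ ^ i * (i : ℝ) :=
  tsum_nonneg fun i => mul_nonneg (pow_nonneg M.γ_pos.le i) i.cast_nonneg

end

section

variable [SigmaFinite ν] {M : MDP S ν m} {C r D : ℝ}
  {π : EuclideanSpace ℝ (Fin n) → S → EuclideanSpace ℝ (Fin m)}
  {θ₀ θ : EuclideanSpace ℝ (Fin n)}

/-- The state laws depend on the policy parameter in a Lipschitz way, in total variation. -/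
theorem SmoothFamily.abs_integral_stateLaw_sub_le (hF : M.SmoothFamily π θ₀ r D)
    (hM : M.RegularWith C) (hθ : θ ∈ Metric.ball θ₀ r) (μ : Measure S) [IsProbabilityMeasure μ]
    (i : ℕ) : ∀ {g : S → ℝ} {G : ℝ}, MeasurableBoundedBy g G → 0 ≤ G →
    |∫ x, g x ∂M.stateLaw (π θ) μ i - ∫ x, g x ∂M.stateLaw (π θ₀) μ i| ≤
      i * (G * (C * (D + D * D) * ‖θ - θ₀‖)) := by
  induction i with
  | zero => intro g G _ _; simp [stateLaw]
  | succ i ih =>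
    intro g G hg hG
    rw [integral_stateLaw_succ (hF.isPolicy θ) μ hg, integral_stateLaw_succ (hF.isPolicy θ₀) μ hg]
    -- One transition kernel is exchanged at a time: the last one costs the one-step bound, and the
    -- rest is the induction hypothesis for the conditional expectation of `g` under `π θ₀`, which
    -- is still bounded by `G`. The errors thus add up to a factor `i`.
    have hP := hg.integral_transition (hF.isPolicy θ)
    have hP₀ := hg.integral_transition (hF.isPolicy θ₀)
    have hd : MeasurableBoundedBy (fun s => ∫ x, g x ∂M.transition s (π θ s) -
        ∫ x, g x ∂M.transition s (π θ₀ s)) (G * (C * (D + D * D) * ‖θ - θ₀‖)) :=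
      ⟨(hP.sub hP₀).measurable, hF.abs_integral_transition_sub_le hM hθ hg hG⟩
    have h1 := abs_integral_stateLaw_le (hF.isPolicy θ) μ hd i
    have := isProbabilityMeasure_stateLaw (hF.isPolicy θ) μ i
    rw [integral_sub (hP.integrable _) (hP₀.integrable _)] at h1
    have h2 := ih hP₀ hG
    push_cast
    rw [add_mul, one_mul, add_comm]
    refine (abs_sub_le _ _ _).trans (add_le_add h1 h2)

theorem abs_integral_visitation_sub_le {π' π'' : S → EuclideanSpace ℝ (Fin m)}
    (hπ' : M.IsPolicy π') (hπ'' : M.IsPolicy π'') {g : S → ℝ} {G c : ℝ}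
    (hg : MeasurableBoundedBy g G)
    (h : ∀ i, |∫ x, g x ∂M.stateLaw π' M.init i - ∫ x, g x ∂M.stateLaw π'' M.init i| ≤ i * c) :
    |∫ x, g x ∂M.visitation π' - ∫ x, g x ∂M.visitation π''| ≤
      (∑' i : ℕ, M.γ ^ i * (i : ℝ)) * c := by
  rw [← ((hasSum_integral_visitation hπ' hg).sub (hasSum_integral_visitation hπ'' hg)).tsum_eq]
  rw [← Real.norm_eq_abs]
  refine tsum_of_norm_bounded ((summable_pow_mul_natCast M).hasSum.mul_right c) fun i => ?_
  rw [← mul_sub, norm_mul, norm_pow, Real.norm_of_nonneg M.γ_pos.le, mul_assoc]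
  exact mul_le_mul_of_nonneg_left (h i) (pow_nonneg M.γ_pos.le i)

theorem SmoothFamily.exists_abs_V_sub_le (hF : M.SmoothFamily π θ₀ r D) (hM : M.RegularWith C) :
    ∃ c, 0 ≤ c ∧ ∀ θ ∈ Metric.ball θ₀ r, ∀ s, |M.V (π θ) s - M.V (π θ₀) s| ≤ c * ‖θ - θ₀‖ := by
  have hγ : 0 < 1 - M.γ := sub_pos.2 M.γ_lt_one
  have hC := hM.nonneg
  have hD := hF.nonneg
  have hW := tsum_pow_mul_natCast_nonneg M
  set W := ∑' i : ℕ, M.γ ^ i * (i : ℝ) with hWdef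
  set K := C * (D + D * D) with hK
  -- The first term sums the change of reward at each time; the second sums the change of the state
  -- laws, which grows linearly in time and is integrated against a reward bounded by `C`.
  refine ⟨(1 - M.γ)⁻¹ * K + W * (C * K), by positivity, fun θ hθ s => ?_⟩
  have hr := measurableBoundedBy_reward hM.abs_R_le (hF.isPolicy θ)
  have hr₀ := measurableBoundedBy_reward hM.abs_R_le (hF.isPolicy θ₀)
  have hrd : MeasurableBoundedBy (fun s => M.R s (π θ s) - M.R s (π θ₀ s)) (K * ‖θ - θ₀‖) :=
    ⟨(hr.sub hr₀).measurable, fun s => (hF.comp (hM.boundedC2On_R s) s).norm_sub_le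
      (convex_ball _ _) hF.mem_ball hθ⟩
  have hs := summable_pow_mul M fun i =>
    abs_integral_stateLaw_le (hF.isPolicy θ) (Measure.dirac s) hr i
  have hs₀ := summable_pow_mul M fun i =>
    abs_integral_stateLaw_le (hF.isPolicy θ₀) (Measure.dirac s) hr₀ i
  rw [V, V, ← hs.tsum_sub hs₀, ← Real.norm_eq_abs]
  have hsum : HasSum (fun i : ℕ => M.γ ^ i * (K * ‖θ - θ₀‖) +
      M.γ ^ i * (i : ℝ) * (C * (K * ‖θ - θ₀‖)))
      (((1 - M.γ)⁻¹ * K + W * (C * K)) * ‖θ - θ₀‖) := by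
    have h := ((hasSum_geometric_of_lt_one M.γ_pos.le M.γ_lt_one).mul_right
      (K * ‖θ - θ₀‖)).add
      ((summable_pow_mul_natCast M).hasSum.mul_right (C * (K * ‖θ - θ₀‖)))
    rwa [← hWdef, show (1 - M.γ)⁻¹ * (K * ‖θ - θ₀‖) + W * (C * (K * ‖θ - θ₀‖)) =
      ((1 - M.γ)⁻¹ * K + W * (C * K)) * ‖θ - θ₀‖ by ring] at h
  refine tsum_of_norm_bounded hsum fun i => ?_
  rw [← mul_sub, norm_mul, norm_pow, Real.norm_of_nonneg M.γ_pos.le, mul_assoc (M.γ ^ i),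
    ← mul_add]
  refine mul_le_mul_of_nonneg_left ?_ (pow_nonneg M.γ_pos.le i)
  have h1 := abs_integral_stateLaw_le (hF.isPolicy θ) (Measure.dirac s) hrd i
  have := isProbabilityMeasure_stateLaw (hF.isPolicy θ) (Measure.dirac s) i
  rw [integral_sub (hr.integrable _) (hr₀.integrable _)] at h1
  have h2 := hF.abs_integral_stateLaw_sub_le hM hθ (Measure.dirac s) i hr₀ hM.nonneg
  exact (abs_sub_le _ _ _).trans (add_le_add h1 h2)

/-- States that are never encountered for `θ₀` are encountered with a probability that is
quadratically small in `θ - θ₀`: transition probabilities that vanish for `θ₀` are minimal there. -/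
theorem SmoothFamily.integral_indicator_stateLaw_le (hF : M.SmoothFamily π θ₀ r D)
    (hM : M.RegularWith C) (hθ : θ ∈ Metric.ball θ₀ r) (i : ℕ) :
    ∀ {N : Set S}, MeasurableSet N → (∀ j, M.stateLaw (π θ₀) M.init j N = 0) →
    ∫ x, N.indicator (fun _ => (1 : ℝ)) x ∂M.stateLaw (π θ) M.init i ≤
      i * (C * (D + D * D) * ‖θ - θ₀‖ ^ 2) := by
  have := M.isProbabilityMeasure_init
  induction i with
  | zero =>
    intro N hN h0
    have : M.init N = 0 := h0 0
    simp [stateLaw, integral_indicator_const _ hN, Measure.real, this]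
  | succ i ih =>
    intro N hN h0
    set f : S → ℝ := N.indicator fun _ => (1 : ℝ) with hf
    have hfb : MeasurableBoundedBy f 1 := MeasurableBoundedBy.indicator_one hN
    have hf0 : ∀ x, 0 ≤ f x := fun x => Set.indicator_nonneg (fun _ _ => zero_le_one) x
    have hP := hfb.integral_transition (hF.isPolicy θ)
    have hP₀ := hfb.integral_transition (hF.isPolicy θ₀)
    have hL := isProbabilityMeasure_stateLaw (hF.isPolicy θ) M.init i
    rw [integral_stateLaw_succ (hF.isPolicy θ) _ hfb]
    -- `N'` is the set of states from which `π θ₀` reaches `N` in one step with positive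
    -- probability. Since `N` is null at time `j + 1`, `N'` is null at time `j`, so the induction
    -- hypothesis applies to it.
    let N' : Set S := {s | ∫ x, f x ∂M.transition s (π θ₀ s) ≠ 0}
    have hN' : MeasurableSet N' := (hP₀.measurable (measurableSet_singleton 0)).compl
    have h0' : ∀ j, M.stateLaw (π θ₀) M.init j N' = 0 := fun j => by
      have hLj := isProbabilityMeasure_stateLaw (hF.isPolicy θ₀) M.init j
      have h1 : ∫ x, f x ∂M.stateLaw (π θ₀) M.init (j + 1) = 0 := by
        rw [hf, integral_indicator_const _ hN, Measure.real, h0 (j + 1)]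
        simp
      rw [integral_stateLaw_succ (hF.isPolicy θ₀) _ hfb] at h1
      exact ae_iff.1 ((integral_eq_zero_iff_of_nonneg (fun s => integral_nonneg hf0)
        (hP₀.integrable _)).1 h1)
    have hbound : ∀ s, ∫ x, f x ∂M.transition s (π θ s) ≤
        N'.indicator (fun _ => (1 : ℝ)) s + C * (D + D * D) * ‖θ - θ₀‖ ^ 2 := fun s => by
      by_cases hs : s ∈ N'
      · rw [Set.indicator_of_mem hs]
        have hC := hM.nonneg
        have hD := hF.nonneg
        exact ((le_abs_self _).trans (hP.abs_le s)).trans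
          (le_add_of_nonneg_right (by positivity))
      · rw [Set.indicator_of_notMem hs, zero_add]
        have hz : ∫ x, f x ∂M.transition s (π θ₀ s) = 0 := not_not.1 hs
        have hc := hF.comp (hM.boundedC2On_transition s hfb zero_le_one) s
        -- Outside `N'` the probability of entering `N` is zero at `θ₀` and nonnegative elsewhere;
        -- its gradient at `θ₀` vanishes, and the Taylor bound is quadratic.
        have hmin : IsLocalMin (fun θ => ∫ x, f x ∂M.transition s (π θ s)) θ₀ :=
          Eventually.of_forall fun θ' => by
            simp only [hz]
            exact integral_nonneg hf0
        have h := hc.norm_sub_le_sq (convex_ball _ _) hF.mem_ball hθ hmin.fderiv_eq_zero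
        rw [hz, sub_zero, one_mul] at h
        exact (le_abs_self _).trans h
    have hN'b := (MeasurableBoundedBy.indicator_one hN').integrable (M.stateLaw (π θ) M.init i)
    refine (integral_mono (hP.integrable _) (hN'b.add (integrable_const _)) hbound).trans ?_
    simp only [Pi.add_apply]
    rw [integral_add hN'b (integrable_const _)]
    have := ih hN' h0'
    simp only [integral_const, probReal_univ, one_smul]
    push_cast
    linarith

end

end MDP

/-! ### The Gauss-Newton form, continuity of `M₂` and the Hessian identity. -/

theorem map_eq_sum_single {F : Type*} [NormedAddCommGroup F] [NormedSpace ℝ F] {m : ℕ}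
    (T : EuclideanSpace ℝ (Fin m) →L[ℝ] F) (v : EuclideanSpace ℝ (Fin m)) :
    T v = ∑ i, v i • T (EuclideanSpace.single i 1) := by
  conv_lhs => rw [← (EuclideanSpace.basisFun (Fin m) ℝ).sum_repr v]
  simp [map_sum]

theorem jacobian_transpose_mul_hessian_mul_jacobian_apply {m n : ℕ}
    (p : EuclideanSpace ℝ (Fin n) → EuclideanSpace ℝ (Fin m))
    (f : EuclideanSpace ℝ (Fin m) → ℝ) (θ : EuclideanSpace ℝ (Fin n))
    (a : EuclideanSpace ℝ (Fin m)) (i j : Fin n) :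
    ((jacobianMatrix p θ).transpose * hessianMatrix f a * jacobianMatrix p θ) i j =
      fderiv ℝ (fderiv ℝ f) a (fderiv ℝ p θ (EuclideanSpace.single i 1))
        (fderiv ℝ p θ (EuclideanSpace.single j 1)) := by
  rw [map_eq_sum_single (fderiv ℝ (fderiv ℝ f) a), sum_apply]
  simp_rw [smul_apply,
    map_eq_sum_single _ (fderiv ℝ p θ (EuclideanSpace.single j 1))]
  simp only [Matrix.mul_apply, Matrix.transpose_apply, jacobianMatrix, hessianMatrix,
    Matrix.of_apply, smul_eq_mul, Finset.sum_mul, Finset.mul_sum]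
  rw [Finset.sum_comm]
  refine Finset.sum_congr rfl fun k _ => Finset.sum_congr rfl fun l _ => ?_
  ring

namespace MDP

variable {S : Type*} [MeasurableSpace S] {ν : Measure S} {m n : ℕ}

/-- The quadratic form under the expectation in `M₂`, with `Q^{π'}` in place of `Q^{π_θ}`. -/
noncomputable def gaussNewtonForm (M : MDP S ν m) (π' : S → EuclideanSpace ℝ (Fin m))
    (π : EuclideanSpace ℝ (Fin n) → S → EuclideanSpace ℝ (Fin m))
    (θ v w : EuclideanSpace ℝ (Fin n)) (s : S) : ℝ :=
  fderiv ℝ (fderiv ℝ (M.Q π' s)) (π θ s) (fderiv ℝ (fun θ => π θ s) θ v)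
    (fderiv ℝ (fun θ => π θ s) θ w)

theorem M₂_apply (M : MDP S ν m)
    (π : EuclideanSpace ℝ (Fin n) → S → EuclideanSpace ℝ (Fin m))
    (θ : EuclideanSpace ℝ (Fin n)) (i j : Fin n) :
    M.M₂ π θ i j = ∫ s, M.gaussNewtonForm (π θ) π θ (EuclideanSpace.single i 1)
      (EuclideanSpace.single j 1) s ∂M.visitation (π θ) :=
  integral_congr_ae (Eventually.of_forall fun _ =>
    jacobian_transpose_mul_hessian_mul_jacobian_apply _ _ _ _ i j)

/-- The bound of the first two action derivatives of the action-value functions. -/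
noncomputable def boundQ (M : MDP S ν m) (C : ℝ) : ℝ := C + |M.γ| * (C / (1 - M.γ) * C)

theorem RegularWith.boundQ_nonneg {M : MDP S ν m} {C : ℝ} (hM : M.RegularWith C) :
    0 ≤ M.boundQ C := by
  have := hM.div_nonneg
  have := hM.nonneg
  unfold boundQ
  positivity

section

variable [SigmaFinite ν] {M : MDP S ν m} {C r D : ℝ}
  {π : EuclideanSpace ℝ (Fin n) → S → EuclideanSpace ℝ (Fin m)}
  {θ₀ θ : EuclideanSpace ℝ (Fin n)}

theorem SmoothFamily.measurableBoundedBy_gaussNewtonForm (hF : M.SmoothFamily π θ₀ r D)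
    (hM : M.RegularWith C) {π' : S → EuclideanSpace ℝ (Fin m)} (hπ' : M.IsPolicy π')
    (hθ : θ ∈ Metric.ball θ₀ r) (v w : EuclideanSpace ℝ (Fin n)) :
    MeasurableBoundedBy (M.gaussNewtonForm π' π θ v w)
      (M.boundQ C * (D * ‖v‖) * (D * ‖w‖)) := by
  refine ⟨?_, fun s => ?_⟩
  · have h2 := hM.stronglyMeasurable_fderiv_fderiv_Q hπ' (hF.isPolicy θ).1
      fun s => hF.mem_interior s θ hθ
    have hb : ∀ {V : Type} [NormedAddCommGroup V] [NormedSpace ℝ V]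
        {T : S → EuclideanSpace ℝ (Fin m) →L[ℝ] V} {u : S → EuclideanSpace ℝ (Fin m)},
        StronglyMeasurable T → StronglyMeasurable u → StronglyMeasurable fun s => T s (u s) :=
      fun hT hu => isBoundedBilinearMap_apply.continuous.comp_stronglyMeasurable (hT.prodMk hu)
    exact (hb (hb h2 (hF.measurable_fderiv hθ v).stronglyMeasurable)
      (hF.measurable_fderiv hθ w).stronglyMeasurable).measurable
  · have hv := (fderiv ℝ (fun θ => π θ s) θ).le_of_opNorm_le
      ((hF.boundedC2On s).norm_fderiv_le θ hθ) v
    have hw := (fderiv ℝ (fun θ => π θ s) θ).le_of_opNorm_le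
      ((hF.boundedC2On s).norm_fderiv_le θ hθ) w
    exact ContinuousLinearMap.le_of_opNorm_le_of_le _ (ContinuousLinearMap.le_of_opNorm_le_of_le _
      ((hM.boundedC2On_Q hπ' s).norm_fderiv_fderiv_le _ (hF.mem_interior s θ hθ)) hv) hw

theorem SmoothFamily.abs_gaussNewtonForm_sub_le (hF : M.SmoothFamily π θ₀ r D)
    (hM : M.RegularWith C) {π' π'' : S → EuclideanSpace ℝ (Fin m)} (hπ' : M.IsPolicy π')
    (hπ'' : M.IsPolicy π'') {c : ℝ} (hc : 0 ≤ c) (hV : ∀ s, |M.V π' s - M.V π'' s| ≤ c)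
    (hθ : θ ∈ Metric.ball θ₀ r) (v w : EuclideanSpace ℝ (Fin n)) (s : S) :
    |M.gaussNewtonForm π' π θ v w s - M.gaussNewtonForm π'' π θ v w s| ≤
      c * C * (D * ‖v‖) * (D * ‖w‖) := by
  have hv := (fderiv ℝ (fun θ => π θ s) θ).le_of_opNorm_le
    ((hF.boundedC2On s).norm_fderiv_le θ hθ) v
  have hw := (fderiv ℝ (fun θ => π θ s) θ).le_of_opNorm_le
    ((hF.boundedC2On s).norm_fderiv_le θ hθ) w
  exact ContinuousLinearMap.le_of_opNorm_le_of_le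
    ((fderiv ℝ (fderiv ℝ (M.Q π' s)) (π θ s) - fderiv ℝ (fderiv ℝ (M.Q π'' s)) (π θ s)) _)
    (ContinuousLinearMap.le_of_opNorm_le_of_le _
      (hM.norm_fderiv_fderiv_Q_sub_le hπ' hπ'' hc hV s (hF.mem_interior s θ hθ)) hv) hw

theorem SmoothFamily.continuousAt_gaussNewtonForm (hF : M.SmoothFamily π θ₀ r D)
    (hM : M.RegularWith C) {π' : S → EuclideanSpace ℝ (Fin m)} (hπ' : M.IsPolicy π')
    (v w : EuclideanSpace ℝ (Fin n)) (s : S) :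
    ContinuousAt (fun θ => M.gaussNewtonForm π' π θ v w s) θ₀ := by
  have h1 : ContinuousAt (fun θ => fderiv ℝ (fderiv ℝ (M.Q π' s)) (π θ s)) θ₀ :=
    ((hM.boundedC2On_Q hπ' s).continuousAt_fderiv_fderiv
      (hF.mem_interior s θ₀ hF.mem_ball)).comp (f := fun θ => π θ s)
      ((hF.boundedC2On s).differentiableAt hF.mem_ball).continuousAt
  have h2 := ((hF.boundedC2On s).differentiableAt_fderiv hF.mem_ball).continuousAt
  exact (h1.clm_apply (h2.clm_apply continuousAt_const)).clm_apply
    (h2.clm_apply continuousAt_const)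

/-- `M₂` is continuous at `θ₀`. -/
theorem SmoothFamily.tendsto_M₂ (hF : M.SmoothFamily π θ₀ r D) (hM : M.RegularWith C)
    (i j : Fin n) : Tendsto (fun θ => M.M₂ π θ i j) (𝓝 θ₀) (𝓝 (M.M₂ π θ₀ i j)) := by
  have hvis := isFiniteMeasure_visitation (hF.isPolicy θ₀)
  have hinit := M.isProbabilityMeasure_init
  obtain ⟨c, hc, hV⟩ := hF.exists_abs_V_sub_le hM
  simp only [M₂_apply]
  set v : EuclideanSpace ℝ (Fin n) := EuclideanSpace.single i 1
  set w : EuclideanSpace ℝ (Fin n) := EuclideanSpace.single j 1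
  have hball : ∀ᶠ θ in 𝓝 θ₀, θ ∈ Metric.ball θ₀ r := Metric.ball_mem_nhds _ hF.pos
  have hnorm : Tendsto (fun θ => ‖θ - θ₀‖) (𝓝 θ₀) (𝓝 0) := tendsto_norm_sub_self θ₀
  -- The three occurrences of `θ` are separated: `h1` moves the visitation measure, `h2` the policy
  -- defining `Q`, and `h3` the point of evaluation. Only `h3` lacks a rate and uses dominated
  -- convergence, the second derivatives being merely continuous.
  have h1 : Tendsto (fun θ => ∫ s, M.gaussNewtonForm (π θ) π θ v w s ∂M.visitation (π θ) -
      ∫ s, M.gaussNewtonForm (π θ) π θ v w s ∂M.visitation (π θ₀)) (𝓝 θ₀) (𝓝 0) := by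
    set G := M.boundQ C * (D * ‖v‖) * (D * ‖w‖) with hG
    have hG0 : 0 ≤ G := by
      have := hM.boundQ_nonneg
      have := hF.nonneg
      positivity
    refine squeeze_zero_norm' (a := fun θ => (∑' i : ℕ, M.γ ^ i * (i : ℝ)) *
      (G * (C * (D + D * D) * ‖θ - θ₀‖))) ?_ ?_
    · filter_upwards [hball] with θ hθ
      have hb := hF.measurableBoundedBy_gaussNewtonForm hM (hF.isPolicy θ) hθ v w
      exact abs_integral_visitation_sub_le (hF.isPolicy θ) (hF.isPolicy θ₀) hb fun i =>
        hF.abs_integral_stateLaw_sub_le hM hθ M.init i hb hG0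
    · simpa using ((hnorm.const_mul (C * (D + D * D))).const_mul G).const_mul
        (∑' i : ℕ, M.γ ^ i * (i : ℝ))
  have h2 : Tendsto (fun θ => ∫ s, (M.gaussNewtonForm (π θ) π θ v w s -
      M.gaussNewtonForm (π θ₀) π θ v w s) ∂M.visitation (π θ₀)) (𝓝 θ₀) (𝓝 0) := by
    refine squeeze_zero_norm' (a := fun θ => c * ‖θ - θ₀‖ * C * (D * ‖v‖) * (D * ‖w‖) *
      (M.visitation (π θ₀)).real Set.univ) ?_ ?_
    · filter_upwards [hball] with θ hθ
      exact norm_integral_le_of_norm_le_const (Eventually.of_forall fun s =>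
        hF.abs_gaussNewtonForm_sub_le hM (hF.isPolicy θ) (hF.isPolicy θ₀) (by positivity)
          (hV θ hθ) hθ v w s)
    · simpa using ((((hnorm.const_mul c).mul_const C).mul_const (D * ‖v‖)).mul_const
        (D * ‖w‖)).mul_const ((M.visitation (π θ₀)).real Set.univ)
  have h3 : Tendsto (fun θ => ∫ s, M.gaussNewtonForm (π θ₀) π θ v w s ∂M.visitation (π θ₀))
      (𝓝 θ₀) (𝓝 (∫ s, M.gaussNewtonForm (π θ₀) π θ₀ v w s ∂M.visitation (π θ₀))) := by
    refine tendsto_integral_filter_of_dominated_convergence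
      (fun _ => M.boundQ C * (D * ‖v‖) * (D * ‖w‖)) ?_ ?_ (integrable_const _)
      (Eventually.of_forall fun s => hF.continuousAt_gaussNewtonForm hM (hF.isPolicy θ₀) v w s)
    · filter_upwards [hball] with θ hθ
      exact (hF.measurableBoundedBy_gaussNewtonForm hM (hF.isPolicy θ₀) hθ v
        w).measurable.aestronglyMeasurable
    · filter_upwards [hball] with θ hθ
      exact Eventually.of_forall
        (hF.measurableBoundedBy_gaussNewtonForm hM (hF.isPolicy θ₀) hθ v w).abs_le
  have h := (h1.add h2).add h3
  rw [zero_add, zero_add] at h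
  refine h.congr' ?_
  filter_upwards [hball] with θ hθ
  rw [integral_sub ((hF.measurableBoundedBy_gaussNewtonForm hM (hF.isPolicy θ) hθ v w).integrable _)
    ((hF.measurableBoundedBy_gaussNewtonForm hM (hF.isPolicy θ₀) hθ v w).integrable _)]
  ring

/-- Near an optimal parameter, `J` is up to third order the expected advantage of the new actions
along the optimal closed loop. -/
theorem SmoothFamily.exists_abs_J_sub_le (hF : M.SmoothFamily π θ₀ r D) (hM : M.RegularWith C)
    (hopt : M.IsUniqueOptimal (π θ₀)) :
    ∃ c, ∀ θ ∈ Metric.ball θ₀ r, |M.J (π θ) - M.J (π θ₀) -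
      ∫ s, (M.Q (π θ₀) s (π θ s) - M.V (π θ₀) s) ∂M.visitation (π θ₀)| ≤ c * ‖θ - θ₀‖ ^ 3 := by
  have hinit := M.isProbabilityMeasure_init
  have hvis := isFiniteMeasure_visitation (hF.isPolicy θ₀)
  obtain ⟨N, hN, hN0, hgrad⟩ := hM.exists_null_fderiv_Q_eq_zero hopt
    fun s => hF.mem_interior s θ₀ hF.mem_ball
  have hC := hM.nonneg
  have hD := hF.nonneg
  have hQ := hM.boundQ_nonneg
  set L := M.boundQ C * (D + D * D) with hL
  set K := C * (D + D * D) with hK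
  have hL0 : 0 ≤ L := by positivity
  -- Each time `i` contributes `i * L * K` twice: off `N` from a quadratic advantage and a linear
  -- change of law, on `N` from a linear advantage and a quadratic probability.
  refine ⟨(∑' i : ℕ, M.γ ^ i * (i : ℝ)) * (2 * L * K), fun θ hθ => ?_⟩
  have hadv := measurableBoundedBy_advantage hM.abs_R_le (hF.isPolicy θ₀) (hF.isPolicy θ)
  have hcomp := fun s => hF.comp (hM.boundedC2On_Q (hF.isPolicy θ₀) s) s
  rw [J_sub_J hM.abs_R_le (hF.isPolicy θ₀) (hF.isPolicy θ)]
  set φ : S → ℝ := fun s => M.Q (π θ₀) s (π θ s) - M.V (π θ₀) s with hφ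
  have hφ1 : MeasurableBoundedBy φ (L * ‖θ - θ₀‖) := ⟨hadv.measurable, fun s => by
    simp only [hφ, V_eq_Q hM.abs_R_le (hF.isPolicy θ₀) s]
    exact (hcomp s).norm_sub_le (convex_ball _ _) hF.mem_ball hθ⟩
  have hφ2 : MeasurableBoundedBy (Nᶜ.indicator φ) (L * ‖θ - θ₀‖ ^ 2) := by
    refine ⟨hadv.measurable.indicator hN.compl, fun s => ?_⟩
    by_cases hs : s ∈ N
    · rw [Set.indicator_of_notMem (by simpa using hs), abs_zero]
      positivity
    · rw [Set.indicator_of_mem (by simpa using hs)]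
      simp only [hφ, V_eq_Q hM.abs_R_le (hF.isPolicy θ₀) s]
      refine (hcomp s).norm_sub_le_sq (convex_ball _ _) hF.mem_ball hθ ?_
      rw [((hM.boundedC2On_Q (hF.isPolicy θ₀) s).fderiv_comp_eventuallyEq (hF.boundedC2On s)
        (hF.mem_interior s) hF.mem_ball).eq_of_nhds, hgrad s hs, ContinuousLinearMap.zero_comp]
  have hφN : MeasurableBoundedBy (N.indicator φ) (L * ‖θ - θ₀‖) := hφ1.indicator hN
  have hi1 : MeasurableBoundedBy (N.indicator fun _ => (1 : ℝ)) 1 :=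
    MeasurableBoundedBy.indicator_one hN
  refine (abs_integral_visitation_sub_le (hF.isPolicy θ) (hF.isPolicy θ₀) hφ1
    (c := 2 * L * K * ‖θ - θ₀‖ ^ 3) fun i => ?_).trans (le_of_eq (by ring))
  have hp := isProbabilityMeasure_stateLaw (hF.isPolicy θ) M.init i
  have hp₀ := isProbabilityMeasure_stateLaw (hF.isPolicy θ₀) M.init i
  have hsplit : ∀ (μ : Measure S) [IsProbabilityMeasure μ],
      ∫ x, φ x ∂μ = ∫ x, Nᶜ.indicator φ x ∂μ + ∫ x, N.indicator φ x ∂μ := fun μ _ => by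
    rw [← integral_add (hφ2.integrable μ) (hφN.integrable μ)]
    refine integral_congr_ae (Eventually.of_forall fun s => ?_)
    by_cases hs : s ∈ N <;> simp [hs]
  have hz : ∫ x, N.indicator φ x ∂M.stateLaw (π θ₀) M.init i = 0 := by
    rw [integral_indicator hN, setIntegral_measure_zero _ (hN0 i)]
  have h1 := hF.abs_integral_stateLaw_sub_le hM hθ M.init i hφ2 (by positivity)
  have h2 : |∫ x, N.indicator φ x ∂M.stateLaw (π θ) M.init i| ≤
      L * ‖θ - θ₀‖ * (i * (K * ‖θ - θ₀‖ ^ 2)) := by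
    have hle : |∫ x, N.indicator φ x ∂M.stateLaw (π θ) M.init i| ≤
        ∫ x, L * ‖θ - θ₀‖ * N.indicator (fun _ => (1 : ℝ)) x ∂M.stateLaw (π θ) M.init i := by
      rw [← Real.norm_eq_abs]
      refine norm_integral_le_of_norm_le ((hi1.const_mul (L * ‖θ - θ₀‖)).integrable
      (M.stateLaw (π θ) M.init i))
        (Eventually.of_forall fun s => ?_)
      by_cases hs : s ∈ N
      · simpa [hs] using hφ1.abs_le s
      · simp [hs]
    rw [integral_const_mul] at hle
    exact hle.trans (mul_le_mul_of_nonneg_left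
      (hF.integral_indicator_stateLaw_le hM hθ i hN hN0) (by positivity))
  rw [hsplit (M.stateLaw (π θ) M.init i), hsplit (M.stateLaw (π θ₀) M.init i), hz, add_zero,
    add_sub_right_comm]
  refine (abs_add_le _ _).trans ((add_le_add h1 h2).trans (le_of_eq ?_))
  ring

/-- At a uniquely optimal parameter, `M₂` and the Hessian of `J` define the same quadratic form. -/
theorem SmoothFamily.integral_gaussNewtonForm_eq (hF : M.SmoothFamily π θ₀ r D)
    (hM : M.RegularWith C) (hopt : M.IsUniqueOptimal (π θ₀))
    (hJ : Differentiable ℝ fun θ => M.J (π θ))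
    (hJ' : DifferentiableAt ℝ (fderiv ℝ fun θ => M.J (π θ)) θ₀)
    (hgrad : fderiv ℝ (fun θ => M.J (π θ)) θ₀ = 0) (v : EuclideanSpace ℝ (Fin n)) :
    ∫ s, M.gaussNewtonForm (π θ₀) π θ₀ v v s ∂M.visitation (π θ₀) =
      fderiv ℝ (fderiv ℝ fun θ => M.J (π θ)) θ₀ v v := by
  have hvis := isFiniteMeasure_visitation (hF.isPolicy θ₀)
  obtain ⟨N, hN, hN0, hgr⟩ := hM.exists_null_fderiv_Q_eq_zero hopt
    fun s => hF.mem_interior s θ₀ hF.mem_ball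
  obtain ⟨c, hc⟩ := hF.exists_abs_J_sub_le hM hopt
  have hNae : ∀ᵐ s ∂M.visitation (π θ₀), s ∉ N :=
    ae_visitation_iff.2 fun i => measure_eq_zero_iff_ae_notMem.1 (hN0 i)
  have hg0 : ∀ s ∉ N, fderiv ℝ (fun θ => M.Q (π θ₀) s (π θ s)) θ₀ = 0 := fun s hs => by
    rw [((hM.boundedC2On_Q (hF.isPolicy θ₀) s).fderiv_comp_eventuallyEq (hF.boundedC2On s)
      (hF.mem_interior s) hF.mem_ball).eq_of_nhds, hgr s hs, ContinuousLinearMap.zero_comp]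
  have hcomp := fun s => hF.comp (hM.boundedC2On_Q (hF.isPolicy θ₀) s) s
  have hVQ := V_eq_Q hM.abs_R_le (hF.isPolicy θ₀)
  have hline : ∀ᶠ t : ℝ in 𝓝[≠] 0, θ₀ + t • v ∈ Metric.ball θ₀ r := by
    have h : Continuous fun t : ℝ => θ₀ + t • v := by fun_prop
    have h0 : Tendsto (fun t : ℝ => θ₀ + t • v) (𝓝 0) (𝓝 θ₀) := by simpa using h.tendsto 0
    exact nhdsWithin_le_nhds (h0.eventually (Metric.ball_mem_nhds _ hF.pos))
  have hne : ∀ᶠ t : ℝ in 𝓝[≠] 0, t ≠ 0 := self_mem_nhdsWithin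
  -- The quotient is dominated by a constant because the advantage is quadratic off the null set
  -- `N`; pointwise it has the second-order Taylor limit, where the vanishing action gradient
  -- removes the second derivative of the policy.
  have hA : Tendsto (fun t : ℝ => ∫ s, (M.Q (π θ₀) s (π (θ₀ + t • v) s) - M.V (π θ₀) s) / t ^ 2
      ∂M.visitation (π θ₀)) (𝓝[≠] 0)
      (𝓝 (∫ s, M.gaussNewtonForm (π θ₀) π θ₀ v v s / 2 ∂M.visitation (π θ₀))) := by
    refine tendsto_integral_filter_of_dominated_convergence
      (fun _ => M.boundQ C * (D + D * D) * ‖v‖ ^ 2) ?_ ?_ (integrable_const _) ?_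
    · exact Eventually.of_forall fun t => ((measurableBoundedBy_advantage hM.abs_R_le
        (hF.isPolicy θ₀) (hF.isPolicy _)).measurable.div_const _).aestronglyMeasurable
    · filter_upwards [hline, hne] with t ht ht0
      filter_upwards [hNae] with s hs
      have h := (hcomp s).norm_sub_le_sq (convex_ball _ _) hF.mem_ball ht (hg0 s hs)
      rw [add_sub_cancel_left, norm_smul, mul_pow, Real.norm_eq_abs t, sq_abs] at h
      rw [hVQ, norm_div, norm_pow, Real.norm_eq_abs t, sq_abs, div_le_iff₀ (by positivity)]
      exact h.trans (le_of_eq (by unfold boundQ; ring))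
    · filter_upwards [hNae] with s hs
      have hd : ∀ᶠ θ in 𝓝 θ₀, DifferentiableAt ℝ (fun θ => M.Q (π θ₀) s (π θ s)) θ :=
        eventually_of_mem (Metric.ball_mem_nhds _ hF.pos) fun θ hθ => (hcomp s).differentiableAt hθ
      have h := tendsto_second_difference hd ((hcomp s).differentiableAt_fderiv hF.mem_ball)
        (hg0 s hs) v
      rw [(hM.boundedC2On_Q (hF.isPolicy θ₀) s).fderiv_fderiv_comp_apply (hF.boundedC2On s)
        (hF.mem_interior s) hF.mem_ball, hgr s hs, zero_apply, zero_add] at h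
      simpa only [hVQ, gaussNewtonForm] using h
  -- The third-order error divided by `t²` is `O(|t|)`.
  have hE : Tendsto (fun t : ℝ => (M.J (π (θ₀ + t • v)) - M.J (π θ₀)) / t ^ 2 -
      ∫ s, (M.Q (π θ₀) s (π (θ₀ + t • v) s) - M.V (π θ₀) s) / t ^ 2 ∂M.visitation (π θ₀))
      (𝓝[≠] 0) (𝓝 0) := by
    refine squeeze_zero_norm' (a := fun t => c * ‖v‖ ^ 3 * |t|) ?_ ?_
    · filter_upwards [hline, hne] with t ht ht0
      have h := hc _ ht
      rw [integral_div, ← sub_div, norm_div, Real.norm_eq_abs, Real.norm_eq_abs, abs_pow,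
        div_le_iff₀ (by positivity)]
      refine h.trans (le_of_eq ?_)
      rw [add_sub_cancel_left, norm_smul, Real.norm_eq_abs]
      ring
    · have : Continuous fun t : ℝ => c * ‖v‖ ^ 3 * |t| := by fun_prop
      have h := (this.tendsto 0).mono_left (nhdsWithin_le_nhds (s := {0}ᶜ))
      simpa using h
  have hJ2 := tendsto_second_difference (Eventually.of_forall fun θ => hJ θ) hJ' hgrad v
  have h := tendsto_nhds_unique hJ2 ((hE.add hA).congr fun t => by ring)
  rw [zero_add, integral_div] at h
  linarith

theorem SmoothFamily.M₂_eq_hessianMatrix (hF : M.SmoothFamily π θ₀ r D)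
    (hM : M.RegularWith C) (hopt : M.IsUniqueOptimal (π θ₀))
    (hJ : Differentiable ℝ fun θ => M.J (π θ))
    (hJ' : DifferentiableAt ℝ (fderiv ℝ fun θ => M.J (π θ)) θ₀)
    (hgrad : fderiv ℝ (fun θ => M.J (π θ)) θ₀ = 0) :
    M.M₂ π θ₀ = hessianMatrix (fun θ => M.J (π θ)) θ₀ := by
  have hvis := isFiniteMeasure_visitation (hF.isPolicy θ₀)
  have hq := hF.integral_gaussNewtonForm_eq hM hopt hJ hJ' hgrad
  have hint := fun v w => (hF.measurableBoundedBy_gaussNewtonForm hM (hF.isPolicy θ₀)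
    hF.mem_ball v w).integrable (M.visitation (π θ₀))
  have hsymm : ∀ v w, fderiv ℝ (fderiv ℝ fun θ => M.J (π θ)) θ₀ v w =
      fderiv ℝ (fderiv ℝ fun θ => M.J (π θ)) θ₀ w v :=
    second_derivative_symmetric_of_eventually
      (Eventually.of_forall fun θ => (hJ θ).hasFDerivAt) hJ'.hasFDerivAt
  ext i j
  rw [M₂_apply, hessianMatrix, Matrix.of_apply]
  set v : EuclideanSpace ℝ (Fin n) := EuclideanSpace.single i 1
  set w : EuclideanSpace ℝ (Fin n) := EuclideanSpace.single j 1
  -- Polarization: both forms are symmetric, so agreement on the diagonal at `v`, `w` and `v + w`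
  -- gives agreement at `(v, w)`.
  have h : ∫ s, M.gaussNewtonForm (π θ₀) π θ₀ (v + w) (v + w) s ∂M.visitation (π θ₀) =
      ∫ s, M.gaussNewtonForm (π θ₀) π θ₀ v v s ∂M.visitation (π θ₀) +
      ∫ s, M.gaussNewtonForm (π θ₀) π θ₀ w w s ∂M.visitation (π θ₀) +
      2 * ∫ s, M.gaussNewtonForm (π θ₀) π θ₀ v w s ∂M.visitation (π θ₀) := by
    rw [← integral_const_mul, ← integral_add (hint v v) (hint w w),
      ← integral_add (f := fun s => M.gaussNewtonForm (π θ₀) π θ₀ v v s +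
        M.gaussNewtonForm (π θ₀) π θ₀ w w s) ((hint v v).add (hint w w))
        ((hint v w).const_mul 2)]
    refine integral_congr_ae (Eventually.of_forall fun s => ?_)
    have hc := (hM.boundedC2On_Q (hF.isPolicy θ₀) s).fderiv_fderiv_comm
      (hF.mem_interior s θ₀ hF.mem_ball) (fderiv ℝ (fun θ => π θ s) θ₀ v)
      (fderiv ℝ (fun θ => π θ s) θ₀ w)
    simp only [gaussNewtonForm, map_add, add_apply]
    rw [← hc]
    ring
  rw [hq, hq, hq] at h
  simp only [map_add, add_apply] at h
  linarith [hsymm v w]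

end

end MDP

/-! ### Superlinear convergence of quasi-Newton iterations. -/

/-- The adjugate formula reduces this to continuity of determinant and adjugate. Singular `B k`,
whose inverse is zero by convention, can be ignored in the limit. -/
theorem Matrix.tendsto_inv_of_det_ne_zero {ι α : Type*} [Fintype ι] [DecidableEq ι]
    {l : Filter α} {B : α → Matrix ι ι ℝ} {H : Matrix ι ι ℝ} (hB : Tendsto B l (𝓝 H))
    (hH : H.det ≠ 0) : Tendsto (fun k => (B k)⁻¹) l (𝓝 H⁻¹) := by
  simp only [Matrix.inv_def, Ring.inverse_eq_inv']
  have hdet : Continuous fun A : Matrix ι ι ℝ => A.det := continuous_id.matrix_det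
  have hadj : Continuous fun A : Matrix ι ι ℝ => A.adjugate := continuous_id.matrix_adjugate
  exact (((hdet.tendsto H).comp hB).inv₀ hH).smul ((hadj.tendsto H).comp hB)

theorem toDual_symm_fderiv_fderiv_apply {n : ℕ} {f : EuclideanSpace ℝ (Fin n) → ℝ}
    {x : EuclideanSpace ℝ (Fin n)} (hsymm : ∀ v w, fderiv ℝ (fderiv ℝ f) x v w =
      fderiv ℝ (fderiv ℝ f) x w v) (v : EuclideanSpace ℝ (Fin n)) :
    (InnerProductSpace.toDual ℝ (EuclideanSpace ℝ (Fin n))).symm (fderiv ℝ (fderiv ℝ f) x v) =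
      Matrix.toEuclideanCLM (𝕜 := ℝ) (hessianMatrix f x) v := by
  ext i
  have h1 : ∀ u : EuclideanSpace ℝ (Fin n), u i = inner ℝ u (EuclideanSpace.single i 1) :=
    fun u => by simp [EuclideanSpace.inner_single_right]
  rw [h1, InnerProductSpace.toDual_symm_apply, hsymm, map_eq_sum_single]
  simp [hessianMatrix, Matrix.mulVec, dotProduct, mul_comm]

/-- First-order expansion of the gradient at a critical point. -/
theorem gradient_sub_hessianMatrix_isLittleO {n : ℕ} {f : EuclideanSpace ℝ (Fin n) → ℝ}
    {x : EuclideanSpace ℝ (Fin n)} (hf : Differentiable ℝ f)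
    (hf' : DifferentiableAt ℝ (fderiv ℝ f) x) (h0 : fderiv ℝ f x = 0) :
    (fun y => gradient f y - Matrix.toEuclideanCLM (𝕜 := ℝ) (hessianMatrix f x) (y - x))
      =o[𝓝 x] fun y => y - x := by
  have hsymm := second_derivative_symmetric_of_eventually
    (Eventually.of_forall fun y => (hf y).hasFDerivAt) hf'.hasFDerivAt
  refine IsLittleO.of_norm_left ?_
  refine hf'.hasFDerivAt.isLittleO.norm_left.congr_left fun y => ?_
  rw [← toDual_symm_fderiv_fderiv_apply hsymm, gradient, ← map_sub, LinearIsometryEquiv.norm_map,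
    h0, sub_zero]

/-- A quasi-Newton iteration whose matrices converge to the invertible Hessian at a critical point
converges superlinearly. -/
theorem convergesSuperlinearly_quasiNewton {n : ℕ} {f : EuclideanSpace ℝ (Fin n) → ℝ}
    {x : EuclideanSpace ℝ (Fin n)} (hf : Differentiable ℝ f)
    (hf' : DifferentiableAt ℝ (fderiv ℝ f) x) (h0 : fderiv ℝ f x = 0)
    (hdet : (hessianMatrix f x).det ≠ 0) {B : ℕ → Matrix (Fin n) (Fin n) ℝ}
    {u : ℕ → EuclideanSpace ℝ (Fin n)}
    (hu : ∀ k, u (k + 1) = u k - Matrix.toEuclideanLin (B k)⁻¹ (gradient f (u k)))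
    (hlim : Tendsto u atTop (𝓝 x)) (hB : Tendsto B atTop (𝓝 (hessianMatrix f x))) :
    ConvergesSuperlinearly u x := by
  refine ⟨hlim, ?_⟩
  set H := hessianMatrix f x with hH
  let T := Matrix.toEuclideanCLM (n := Fin n) (𝕜 := ℝ)
  have hT : Continuous T :=
    LinearMap.continuous_of_finiteDimensional (T.toAlgEquiv.toLinearMap :
      Matrix (Fin n) (Fin n) ℝ →ₗ[ℝ] _)
  have hinv := Matrix.tendsto_inv_of_det_ne_zero hB hdet
  have hTinv : Tendsto (fun k => T (B k)⁻¹) atTop (𝓝 (T H⁻¹)) := (hT.tendsto _).comp hinv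
  -- With `g` the gradient, the new error is `(1 - B⁻¹ H)(u - x) - B⁻¹ (g(u) - H (u - x))`. The
  -- first operator tends to zero; in the second term `B⁻¹` stays bounded and the bracket is `o(‖u -
  -- x‖)`.
  have hone : Tendsto (fun k => T (1 - (B k)⁻¹ * H)) atTop (𝓝 0) := by
    have h : Tendsto (fun k => 1 - (B k)⁻¹ * H) atTop (𝓝 (1 - H⁻¹ * H)) :=
      tendsto_const_nhds.sub (hinv.mul tendsto_const_nhds)
    rw [Matrix.nonsing_inv_mul _ (isUnit_iff_ne_zero.2 hdet), sub_self] at h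
    have h' := (hT.tendsto 0).comp h
    rwa [map_zero] at h'
  have hr := (gradient_sub_hessianMatrix_isLittleO hf hf' h0).comp_tendsto hlim
  have h1 : (fun k => T (1 - (B k)⁻¹ * H) (u k - x)) =o[atTop] fun k => u k - x := by
    have h := (isLittleO_one_iff ℝ).2 hone |>.norm_left.mul_isBigO
      (isBigO_refl (fun k => ‖u k - x‖) atTop)
    refine IsLittleO.of_norm_right ((IsBigO.of_bound 1
      (Eventually.of_forall fun k => ?_)).trans_isLittleO
      (h.congr_right fun k => one_mul _))
    simpa using (T (1 - (B k)⁻¹ * H)).le_opNorm (u k - x)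
  have h2 : (fun k => T (B k)⁻¹ (gradient f (u k) - T H (u k - x))) =o[atTop]
      fun k => u k - x := by
    have h := (hTinv.isBigO_one ℝ).norm_left.mul_isLittleO hr.norm_norm
    refine IsLittleO.of_norm_right ((IsBigO.of_bound 1
      (Eventually.of_forall fun k => ?_)).trans_isLittleO
      (h.congr_right fun k => one_mul _))
    simpa using (T (B k)⁻¹).le_opNorm (gradient f (u k) - T H (u k - x))
  refine (h1.sub h2).congr_left fun k => ?_
  have h3 : Matrix.toEuclideanLin (B k)⁻¹ (gradient f (u k)) = T (B k)⁻¹ (gradient f (u k)) := rfl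
  have h4 : T (1 - (B k)⁻¹ * H) (u k - x) = (u k - x) - T (B k)⁻¹ (T H (u k - x)) := by
    rw [map_sub T, map_one, map_mul]
    rfl
  rw [hu, h3, h4, map_sub (T (B k)⁻¹)]
  abel

theorem mainTheorem2 {S : Type*} [MeasurableSpace S] (ν : Measure S) [SigmaFinite ν] {m n : ℕ}
    (M : MDP S ν m) (hM : M.IsRegular)
    -- the parameterized policy
    (π : EuclideanSpace ℝ (Fin n) → S → EuclideanSpace ℝ (Fin m))
    (hπ : ∀ θ, M.IsPolicy (π θ))
    -- the unique optimal policy, and the parameter at which it is attained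
    (πstar : S → EuclideanSpace ℝ (Fin m)) (hopt : M.IsUniqueOptimal πstar)
    (θstar : EuclideanSpace ℝ (Fin n)) (hrich : ∀ s, π θstar s = πstar s)
    (hreg : M.IsRegularPolicyNear π θstar)
    -- `J` is twice differentiable, with vanishing gradient and negative definite Hessian at `θstar`
    (hJ : Differentiable ℝ fun θ => M.J (π θ))
    (hJ' : Differentiable ℝ (fderiv ℝ fun θ => M.J (π θ)))
    (hgrad : gradient (fun θ => M.J (π θ)) θstar = 0)
    (hhess : (-hessianMatrix (fun θ => M.J (π θ)) θstar).PosDef)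
    -- the quasi-Newton iteration with `B_k = M₂(θ_k)`, assumed to converge to `θstar`
    (θ : ℕ → EuclideanSpace ℝ (Fin n))
    (hstep : ∀ k, θ (k + 1) = θ k -
      Matrix.toEuclideanLin (M.M₂ π (θ k))⁻¹ (gradient (fun θ' => M.J (π θ')) (θ k)))
    (hlim : Tendsto θ atTop (𝓝 θstar)) :
    ConvergesSuperlinearly θ θstar := by
  obtain rfl : π θstar = πstar := funext hrich
  obtain ⟨C, hC⟩ := hM.exists_regularWith
  obtain ⟨r, D, hF⟩ := hreg.exists_smoothFamily hπ
  have h0 : fderiv ℝ (fun θ => M.J (π θ)) θstar = 0 := by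
    simpa [gradient] using hgrad
  -- Only invertibility of the Hessian is used from here on; the sign `(-1)^n` of the determinant is
  -- discarded.
  have hdet : (hessianMatrix (fun θ => M.J (π θ)) θstar).det ≠ 0 := by
    have h := hhess.det_pos.ne'
    rw [Matrix.det_neg] at h
    exact right_ne_zero_of_mul h
  refine convergesSuperlinearly_quasiNewton hJ (hJ' θstar) h0 hdet hstep hlim ?_
  rw [← hF.M₂_eq_hessianMatrix hC hopt hJ (hJ' θstar) h0]
  exact tendsto_pi_nhds.2 fun i => tendsto_pi_nhds.2 fun j => (hF.tendsto_M₂ hC i j).comp hlim
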